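/- Let $n\ge 3$ and $\ell\ge 2$ be integers, let $\zeta\in\mathbb{C}$ be a primitive $\ell$-th root of unity, and let $t=(t_1,\dots,t_n)\in\mathbb{C}^n$. All subscripts are taken modulo $n$. Let $V=\mathbb{C}^n$ with standard basis $x_1,\dots,x_n$, and let $G\subset SL_n(\mathbb{C})$ be the group of all diagonal matrices $g$ with $g^\ell=1$. For $i=1,\dots,n$ let $g_i\in G$ be given by $g_i(x_i)=\zeta x_i$, $g_i(x_{i+1})=\zeta^{-1}x_{i+1}$ and $g_i(x_j)=x_j$ for $j\neq i,i+1$; then $G\cong(\mathbb{Z}/\ell\mathbb{Z})^{n-1}$ is freely generated, as a $\mathbb{Z}/\ell\mathbb{Z}$-module, by $g_1,\dots,g_{n-1}$. Let $\alpha:G\times G\to\mathbb{C}^\times$ be the $2$-cocycle $$\alpha\big(g_1^{i_1}\cdots g_{n-1}^{i_{n-1}},\,g_1^{j_1}\cdots g_{n-1}^{j_{n-1}}\big)=\zeta^{-i_1j_2-i_2j_3-\cdots-i_{n-2}j_{n-1}}.$$ Let $TV\#_\alpha G$ be the crossed product of the tensor algebra $TV$ with $G$, i.e. the vector space $TV\otimes\mathbb{C}G$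 with product $(r\otimes g)(s\otimes h)=\alpha(g,h)\,r\,(g\cdot s)\otimes gh$; the product of $g,h\in G$ in this algebra is written $g*h=\alpha(g,h)\,gh$. Let $\mathsf{H}$ be the quotient of $TV\#_\alpha G$ by the relations $$x_ix_{i+1}-x_{i+1}x_i=t_ig_i,\qquad x_ix_j-x_jx_i=0$$ for all $i,j\in\{1,\dots,n\}$ with $|i-j|\notin\{1,n-1\}$. Let $J$ be the set of all subsets $\{i_1<\dots<i_k\}$ of $\{1,\dots,n\}$ ($k\ge 0$) with $|i_r-i_s|\notin\{1,n-1\}$ for all $r,s$. Put $\delta=(1,\dots,1)\in\mathbb{Z}^n$, let $\varepsilon_i\in\mathbb{Z}^n$ be the vector with entries $1$ in positions $i$ and $i+1$ and $0$ elsewhere, and write $x^p=x_1^{p_1}\cdots x_n^{p_n}$. Put $\tau_i=\frac{t_i}{\zeta-1}$ for $1\le i\le n-1$ and $\tau_n=\frac{\zeta t_n}{\zeta-1}$, and $$w=\sum_{\{i_1<\dots<i_k\}\in J}\tau_{i_1}\cdots\tau_{i_k}\,x^{\delta-\varepsilon_{i_1}-\cdots-\varepsilon_{i_k}}\,g_{i_1}*\cdots*g_{i_k}\in\mathsf{H}.$$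 Then the center of $\mathsf{H}$ is generated, as a $\mathbb{C}$-algebra, by $x_1^\ell,\dots,x_n^\ell$ and $w$. -/

import Mathlib

noncomputable section

namespace HomocyclicHecke

/-! ### Crossed products twisted by a 2-cocycle -/

/-- A normalized `ℂˣ`-valued 2-cocycle of `G` (trivial action on `ℂˣ`). -/
structure TwoCocycle (G : Type*) [Group G] where
  /-- the underlying function -/
  toFun : G → G → ℂˣ
  cocycle : ∀ f g h, toFun f g * toFun (f * g) h = toFun g h * toFun f (g * h)
  one_left : ∀ g, toFun 1 g = 1
  one_right : ∀ g, toFun g 1 = 1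

/-- The underlying space `E ⊗ ℂG` of the crossed product `E #_α G`, realized as the finitely
supported functions `G → E`; `Finsupp.single g r` is `r ⊗ g`. -/
def CrossedProduct {G E : Type*} [Group G] [Ring E] [Algebra ℂ E]
    (_ρ : G →* (E ≃ₐ[ℂ] E)) (_α : TwoCocycle G) : Type _ := G →₀ E

namespace CrossedProduct

section

variable {G E : Type*} [Group G] [Ring E] [Algebra ℂ E]
  (ρ : G →* (E ≃ₐ[ℂ] E)) (α : TwoCocycle G)

instance : AddCommGroup (CrossedProduct ρ α) := inferInstanceAs (AddCommGroup (G →₀ E))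

instance : Module ℂ (CrossedProduct ρ α) := inferInstanceAs (Module ℂ (G →₀ E))

/-- The element `r ⊗ g`. -/
def tmul (r : E) (g : G) : CrossedProduct ρ α := Finsupp.single g r

/-- The product on `G →₀ E`: `(r ⊗ g) (s ⊗ h) = α(g, h) r (g · s) ⊗ g h`, extended
biadditively. -/
def mulFun (a b : G →₀ E) : G →₀ E :=
  a.sum fun g r => b.sum fun h s =>
    Finsupp.single (g * h) ((α.toFun g h : ℂ) • (r * ρ g s))

theorem mulFun_single (r s : E) (g h : G) :
    mulFun ρ α (Finsupp.single g r) (Finsupp.single h s)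
      = Finsupp.single (g * h) ((α.toFun g h : ℂ) • (r * ρ g s)) := by
  rw [mulFun, Finsupp.sum_single_index, Finsupp.sum_single_index] <;> simp

theorem mulFun_add (a b c : G →₀ E) : mulFun ρ α a (b + c) = mulFun ρ α a b + mulFun ρ α a c := by
  simp only [mulFun]
  rw [← Finsupp.sum_add]
  refine Finsupp.sum_congr fun g _ => ?_
  refine Finsupp.sum_add_index' (fun h => ?_) (fun h s s' => ?_)
  · simp
  · simp [mul_add]

theorem add_mulFun (a b c : G →₀ E) : mulFun ρ α (a + b) c = mulFun ρ α a c + mulFun ρ α b c := by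
  simp only [mulFun]
  refine Finsupp.sum_add_index' (fun h => ?_) (fun h s s' => ?_)
  · simp
  · rw [← Finsupp.sum_add]
    refine Finsupp.sum_congr fun g _ => ?_
    simp [add_mul]

theorem zero_mulFun (a : G →₀ E) : mulFun ρ α 0 a = 0 := by
  simp [mulFun]

theorem mulFun_zero (a : G →₀ E) : mulFun ρ α a 0 = 0 := by
  simp [mulFun]

instance : Mul (CrossedProduct ρ α) := ⟨mulFun ρ α⟩

instance : One (CrossedProduct ρ α) := ⟨tmul ρ α 1 1⟩

variable {ρ α}

theorem one_def : (1 : CrossedProduct ρ α) = tmul ρ α 1 1 := rfl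

theorem smul_tmul (c : ℂ) (r : E) (g : G) : c • tmul ρ α r g = tmul ρ α (c • r) g :=
  Finsupp.smul_single c g r

theorem tmul_mul_tmul (r s : E) (g h : G) :
    tmul ρ α r g * tmul ρ α s h = tmul ρ α ((α.toFun g h : ℂ) • (r * ρ g s)) (g * h) :=
  mulFun_single ρ α r s g h

theorem induction {p : CrossedProduct ρ α → Prop} (a : CrossedProduct ρ α) (zero : p 0)
    (add : ∀ a b, p a → p b → p (a + b)) (tmul : ∀ r g, p (tmul ρ α r g)) : p a :=
  Finsupp.induction_linear (motive := p) a zero add fun g r => tmul r g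

instance : NonUnitalNonAssocRing (CrossedProduct ρ α) :=
  { (inferInstance : AddCommGroup (CrossedProduct ρ α)),
    (inferInstance : Mul (CrossedProduct ρ α)) with
    left_distrib := mulFun_add ρ α
    right_distrib := add_mulFun ρ α
    zero_mul := fun a => zero_mulFun ρ α a
    mul_zero := fun a => mulFun_zero ρ α a }

theorem assoc (a b c : CrossedProduct ρ α) : a * b * c = a * (b * c) := by
  induction a using CrossedProduct.induction with
  | zero => simp
  | add a a' h h' => simp only [add_mul, h, h']
  | tmul r f =>
  induction b using CrossedProduct.induction with
  | zero => simp
  | add a a' h h' => simp only [add_mul, mul_add, h, h']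
  | tmul s g =>
  induction c using CrossedProduct.induction with
  | zero => simp
  | add a a' h h' => simp only [mul_add, h, h']
  | tmul u h =>
  have key : (α.toFun (f * g) h : ℂ) * (α.toFun f g : ℂ)
      = (α.toFun f (g * h) : ℂ) * (α.toFun g h : ℂ) := by
    have := congrArg (Units.val) (α.cocycle f g h)
    simp only [Units.val_mul] at this
    rw [mul_comm, this, mul_comm]
  simp only [tmul_mul_tmul, map_smul, map_mul, smul_mul_assoc, mul_smul_comm, smul_smul, key,
    mul_assoc, AlgEquiv.mul_apply]

theorem one_mul' (a : CrossedProduct ρ α) : 1 * a = a := by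
  induction a using CrossedProduct.induction with
  | zero => simp
  | add a a' h h' => simp only [mul_add, h, h']
  | tmul r f => simp [one_def, tmul_mul_tmul, α.one_left]

theorem mul_one' (a : CrossedProduct ρ α) : a * 1 = a := by
  induction a using CrossedProduct.induction with
  | zero => simp
  | add a a' h h' => simp only [add_mul, h, h']
  | tmul r f => simp [one_def, tmul_mul_tmul, α.one_right]

instance : Ring (CrossedProduct ρ α) :=
  { (inferInstance : NonUnitalNonAssocRing (CrossedProduct ρ α)),
    (inferInstance : One (CrossedProduct ρ α)) with
    mul_assoc := assoc
    one_mul := one_mul'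
    mul_one := mul_one' }

theorem smul_mul' (c : ℂ) (a b : CrossedProduct ρ α) : (c • a) * b = c • (a * b) := by
  induction a using CrossedProduct.induction with
  | zero => simp
  | add a a' h h' => simp only [add_mul, smul_add, h, h']
  | tmul r f =>
  induction b using CrossedProduct.induction with
  | zero => simp
  | add a a' h h' => simp only [mul_add, smul_add, h, h']
  | tmul s g => simp only [smul_tmul, tmul_mul_tmul, smul_mul_assoc, smul_smul, mul_comm]

theorem mul_smul' (c : ℂ) (a b : CrossedProduct ρ α) : a * (c • b) = c • (a * b) := by
  induction a using CrossedProduct.induction with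
  | zero => simp
  | add a a' h h' => simp only [add_mul, smul_add, h, h']
  | tmul r f =>
  induction b using CrossedProduct.induction with
  | zero => simp
  | add a a' h h' => simp only [mul_add, smul_add, h, h']
  | tmul s g =>
    simp only [smul_tmul, tmul_mul_tmul, map_smul, mul_smul_comm, smul_smul, mul_comm]

instance : Algebra ℂ (CrossedProduct ρ α) :=
  Algebra.ofModule smul_mul' mul_smul'

end

end CrossedProduct

/-! ### The homocyclic group -/

/-- The group of diagonal matrices `g ∈ SL_n(ℂ)` with `g ^ ℓ = 1`. -/
def diagGroup (n ℓ : ℕ) : Subgroup (Matrix.SpecialLinearGroup (Fin n) ℂ) where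
  carrier := {g | (g : Matrix (Fin n) (Fin n) ℂ).IsDiag ∧ g ^ ℓ = 1}
  one_mem' := ⟨Matrix.isDiag_one, one_pow ℓ⟩
  mul_mem' := by
    rintro a b ⟨ha, ha'⟩ ⟨hb, hb'⟩
    have hcomm : Commute a b := by
      apply Subtype.ext
      rw [Matrix.SpecialLinearGroup.coe_mul, Matrix.SpecialLinearGroup.coe_mul,
        ← ha.diagonal_diag, ← hb.diagonal_diag, Matrix.diagonal_mul_diagonal,
        Matrix.diagonal_mul_diagonal]
      simp only [mul_comm]
    refine ⟨?_, by rw [hcomm.mul_pow, ha', hb', one_mul]⟩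
    rw [Matrix.SpecialLinearGroup.coe_mul, ← ha.diagonal_diag, ← hb.diagonal_diag,
      Matrix.diagonal_mul_diagonal]
    exact Matrix.isDiag_diagonal _
  inv_mem' := by
    rintro a ⟨ha, ha'⟩
    refine ⟨?_, by rw [inv_pow, ha', inv_one]⟩
    rw [Matrix.SpecialLinearGroup.coe_inv, ← ha.diagonal_diag, Matrix.adjugate_diagonal]
    exact Matrix.isDiag_diagonal _

theorem coe_eq_diagonal {n ℓ : ℕ} (g : diagGroup n ℓ) :
    (g.1 : Matrix (Fin n) (Fin n) ℂ) = Matrix.diagonal fun j => g.1.1 j j :=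
  (g.2.1.diagonal_diag).symm

theorem mul_diag {n ℓ : ℕ} (g h : diagGroup n ℓ) (j : Fin n) :
    (g * h).1.1 j j = g.1.1 j j * h.1.1 j j := by
  have : (g * h).1.1 = g.1.1 * h.1.1 := rfl
  rw [this, coe_eq_diagonal g, coe_eq_diagonal h, Matrix.diagonal_mul_diagonal]
  simp

theorem ext_diag {n ℓ : ℕ} {g h : diagGroup n ℓ} (H : ∀ j, g.1.1 j j = h.1.1 j j) : g = h := by
  apply Subtype.ext
  apply Subtype.ext
  rw [coe_eq_diagonal g, coe_eq_diagonal h]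
  simp only [H]

instance (n ℓ : ℕ) : CommGroup (diagGroup n ℓ) :=
  { (inferInstance : Group (diagGroup n ℓ)) with
    mul_comm := fun g h => ext_diag fun j => by rw [mul_diag, mul_diag, mul_comm] }

/-- The diagonal entries of the generator `g_i`: `ζ` at `i`, `ζ⁻¹` at `i + 1` (cyclically),
and `1` elsewhere. -/
def genEntry {n : ℕ} [NeZero n] (ζ : ℂ) (i j : Fin n) : ℂ :=
  if j = i then ζ else if j = i + 1 then ζ⁻¹ else 1

theorem succ_ne {n : ℕ} [NeZero n] (hn : 3 ≤ n) (i : Fin n) : i + 1 ≠ i := by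
  intro h
  have h1 : (1 : Fin n) = 0 := by simpa using h
  have := congrArg Fin.val h1
  rw [Fin.val_one', Fin.val_zero, Nat.mod_eq_of_lt (by omega)] at this
  omega

theorem genEntry_eq {n : ℕ} [NeZero n] (hn : 3 ≤ n) (ζ : ℂ) (i j : Fin n) :
    genEntry ζ i j = (if j = i then ζ else 1) * (if j = i + 1 then ζ⁻¹ else 1) := by
  unfold genEntry
  by_cases h : j = i
  · subst h; simp [(succ_ne hn j).symm]
  · simp [h]

/-- The generator `g_i` as an element of `SL_n(ℂ)`. -/
def genSL {n : ℕ} [NeZero n] (hn : 3 ≤ n) {ζ : ℂ} (hζ0 : ζ ≠ 0) (i : Fin n) :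
    Matrix.SpecialLinearGroup (Fin n) ℂ :=
  ⟨Matrix.diagonal (genEntry ζ i), by
    rw [Matrix.det_diagonal]
    simp only [genEntry_eq hn, Finset.prod_mul_distrib, Finset.prod_ite_eq', Finset.mem_univ,
      if_true]
    exact mul_inv_cancel₀ hζ0⟩

/-- The generator `g_i` of the group. -/
def gen {n ℓ : ℕ} [NeZero n] (hn : 3 ≤ n) (hℓ : 2 ≤ ℓ) {ζ : ℂ} (hζ : IsPrimitiveRoot ζ ℓ)
    (i : Fin n) : diagGroup n ℓ :=
  ⟨genSL hn (hζ.ne_zero (by omega)) i, by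
    refine ⟨Matrix.isDiag_diagonal _, ?_⟩
    apply Subtype.ext
    rw [Matrix.SpecialLinearGroup.coe_pow, Matrix.SpecialLinearGroup.coe_one]
    change Matrix.diagonal (genEntry ζ i) ^ ℓ = 1
    rw [Matrix.diagonal_pow, ← Matrix.diagonal_one]
    congr 1
    funext j
    simp only [Pi.pow_apply, genEntry]
    split_ifs <;> simp [hζ.pow_eq_one]⟩

section Cocycle

variable {n ℓ : ℕ}

/-- The product of the first `k + 1` diagonal entries. -/
def partialProd (k : ℕ) : diagGroup n ℓ →* ℂ where
  toFun g := ∏ j : Fin n with j.val ≤ k, g.1.1 j j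
  map_one' := by
    refine Finset.prod_eq_one fun j _ => ?_
    change (1 : Matrix (Fin n) (Fin n) ℂ) j j = 1
    simp
  map_mul' g h := by simp only [mul_diag, Finset.prod_mul_distrib]

theorem partialProd_zpow (k : ℕ) (g : diagGroup n ℓ) (z : ℤ) :
    partialProd k (g ^ z) = partialProd k g ^ z :=
  ((partialProd k).toHomUnits.map_zpow g z ▸ Units.val_zpow_eq_zpow_val _ _ :
    ((partialProd k).toHomUnits (g ^ z) : ℂ) = _)

theorem ext_partialProd {g h : diagGroup n ℓ}
    (H : ∀ k < n - 1, partialProd k g = partialProd k h) : g = h := by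
  have H' : ∀ k < n, partialProd k g = partialProd k h := by
    intro k hk
    rcases Nat.lt_or_ge k (n - 1) with h1 | h1
    · exact H k h1
    · have aux : ∀ f : diagGroup n ℓ, partialProd k f = 1 := by
        intro f
        have hf : (f.1 : Matrix (Fin n) (Fin n) ℂ).det = 1 := f.1.2
        rw [coe_eq_diagonal, Matrix.det_diagonal] at hf
        rw [← hf]
        change ∏ j : Fin n with j.val ≤ k, f.1.1 j j = _
        rw [Finset.filter_true_of_mem]
        intro j _
        have := j.2
        omega
      rw [aux, aux]
  have step : ∀ (f : diagGroup n ℓ) (k : ℕ) (hk : k + 1 < n),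
      partialProd (k + 1) f = partialProd k f * f.1.1 ⟨k + 1, hk⟩ ⟨k + 1, hk⟩ := by
    intro f k hk
    change ∏ j : Fin n with j.val ≤ k + 1, f.1.1 j j
      = (∏ j : Fin n with j.val ≤ k, f.1.1 j j) * _
    have : (Finset.univ.filter fun j : Fin n => j.val ≤ k + 1)
        = insert ⟨k + 1, hk⟩ (Finset.univ.filter fun j : Fin n => j.val ≤ k) := by
      ext j
      simp only [Finset.mem_filter, Finset.mem_univ, true_and, Finset.mem_insert, Fin.ext_iff]
      omega
    rw [this, Finset.prod_insert (by simp), mul_comm]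
  have zero : ∀ (f : diagGroup n ℓ) (hk : 0 < n), partialProd 0 f = f.1.1 ⟨0, hk⟩ ⟨0, hk⟩ := by
    intro f hk
    change ∏ j : Fin n with j.val ≤ 0, f.1.1 j j = _
    have : (Finset.univ.filter fun j : Fin n => j.val ≤ 0) = {⟨0, hk⟩} := by
      ext j
      simp only [Finset.mem_filter, Finset.mem_univ, true_and, Finset.mem_singleton, Fin.ext_iff]
      omega
    rw [this, Finset.prod_singleton]
  refine ext_diag fun j => ?_
  obtain ⟨j, hj⟩ := j
  cases j with
  | zero => rw [← zero, ← zero, H' 0 hj]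
  | succ k =>
    have h1 := H' (k + 1) hj
    rw [step g k hj, step h k hj, H' k (by omega)] at h1
    refine mul_left_cancel₀ ?_ h1
    exact ((partialProd k).toHomUnits h).ne_zero

variable [NeZero n] (hn : 3 ≤ n) (hℓ : 2 ≤ ℓ) {ζ : ℂ} (hζ : IsPrimitiveRoot ζ ℓ)

/-- The element `g_1^{a_1} ⋯ g_{n-1}^{a_{n-1}}` (all indices are shifted by one here). -/
def word (a : ℕ → ℤ) : diagGroup n ℓ :=
  ∏ k ∈ Finset.range (n - 1), gen hn hℓ hζ (Fin.ofNat n k) ^ a k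

theorem partialProd_gen {k m : ℕ} (hm : m < n - 1) :
    partialProd k (gen hn hℓ hζ (Fin.ofNat n m)) = if m = k then ζ else 1 := by
  have hζ0 : ζ ≠ 0 := hζ.ne_zero (by omega)
  have h1 : (Fin.ofNat n m).val = m := by simp [Fin.ofNat, Nat.mod_eq_of_lt (show m < n by omega)]
  have h2 : (Fin.ofNat n m + 1).val = m + 1 := by
    rw [Fin.val_add, h1, Fin.val_one', Nat.mod_eq_of_lt (show 1 < n by omega),
      Nat.mod_eq_of_lt (by omega)]
  change ∏ j : Fin n with j.val ≤ k, Matrix.diagonal (genEntry ζ (Fin.ofNat n m)) j j = _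
  simp only [Matrix.diagonal_apply_eq, genEntry_eq hn, Finset.prod_mul_distrib,
    Finset.prod_ite_eq', Finset.mem_filter, Finset.mem_univ, true_and, h1, h2]
  rcases lt_trichotomy m k with h | h | h
  · rw [if_pos h.le, if_pos (by omega), if_neg h.ne, mul_inv_cancel₀ hζ0]
  · rw [if_pos h.le, if_neg (by omega), if_pos h, mul_one]
  · rw [if_neg (by omega), if_neg (by omega), if_neg (by omega), mul_one]

theorem partialProd_word {k : ℕ} (hk : k < n - 1) (a : ℕ → ℤ) :
    partialProd k (word hn hℓ hζ a) = ζ ^ a k := by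
  rw [word, map_prod, Finset.prod_eq_single k]
  · rw [partialProd_zpow, partialProd_gen hn hℓ hζ hk, if_pos rfl]
  · intro m hm hmk
    rw [partialProd_zpow, partialProd_gen hn hℓ hζ (Finset.mem_range.1 hm), if_neg hmk, one_zpow]
  · intro h
    exact absurd (Finset.mem_range.2 hk) h

theorem word_add (a b : ℕ → ℤ) :
    word hn hℓ hζ (a + b) = word hn hℓ hζ a * word hn hℓ hζ b := by
  simp only [word, Pi.add_apply, zpow_add, Finset.prod_mul_distrib]

theorem word_zero : word hn hℓ hζ 0 = 1 := by simp [word]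

theorem exists_word (g : diagGroup n ℓ) : ∃ a : ℕ → ℤ, g = word hn hℓ hζ a := by
  have : NeZero ℓ := ⟨by omega⟩
  have h : ∀ k, ∃ z : ℤ, ζ ^ z = partialProd k g := by
    intro k
    have hg : g ^ ℓ = 1 := Subtype.ext g.2.2
    obtain ⟨i, -, hi⟩ := hζ.eq_pow_of_pow_eq_one
      (show partialProd k g ^ ℓ = 1 by rw [← map_pow, hg, map_one])
    exact ⟨i, by rw [zpow_natCast, hi]⟩
  choose a ha using h
  exact ⟨a, ext_partialProd fun k hk => by rw [partialProd_word hn hℓ hζ hk, ha]⟩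

/-- Exponents `a` with `g = g_1^{a_1} ⋯ g_{n-1}^{a_{n-1}}`; they are unique modulo `ℓ`. -/
def expo (g : diagGroup n ℓ) : ℕ → ℤ := (exists_word hn hℓ hζ g).choose

theorem word_expo (g : diagGroup n ℓ) : word hn hℓ hζ (expo hn hℓ hζ g) = g :=
  (exists_word hn hℓ hζ g).choose_spec.symm

/-- The value `ζ ^ (- i_1 j_2 - i_2 j_3 - ⋯ - i_{n-2} j_{n-1})` at two elements with exponents
`i` and `j`. -/
def alphaFun (g h : diagGroup n ℓ) : ℂˣ :=
  Units.mk0 ζ (hζ.ne_zero (by omega)) ^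
    (-∑ k ∈ Finset.range (n - 2), expo hn hℓ hζ g k * expo hn hℓ hζ h (k + 1))

/-- The cocycle does not depend on the choice of the exponents. -/
theorem alphaFun_word (i j : ℕ → ℤ) :
    (alphaFun hn hℓ hζ (word hn hℓ hζ i) (word hn hℓ hζ j) : ℂ)
      = ζ ^ (-∑ k ∈ Finset.range (n - 2), i k * j (k + 1)) := by
  have hζ0 : ζ ≠ 0 := hζ.ne_zero (by omega)
  have key : ∀ (a : ℕ → ℤ) (k : ℕ), k < n - 1 →
      ζ ^ expo hn hℓ hζ (word hn hℓ hζ a) k = ζ ^ a k := by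
    intro a k hk
    rw [← partialProd_word hn hℓ hζ hk, word_expo, partialProd_word hn hℓ hζ hk]
  rw [alphaFun, Units.val_zpow_eq_zpow_val, Units.val_mk0, zpow_neg, zpow_neg]
  congr 1
  have hsum : ∀ f : ℕ → ℤ, ζ ^ (∑ k ∈ Finset.range (n - 2), f k)
      = ∏ k ∈ Finset.range (n - 2), ζ ^ f k := by
    intro f
    induction n - 2 with
    | zero => simp
    | succ m ih => rw [Finset.sum_range_succ, Finset.prod_range_succ, zpow_add₀ hζ0, ih]
  rw [hsum, hsum]
  refine Finset.prod_congr rfl fun k hk => ?_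
  have hk' := Finset.mem_range.1 hk
  rw [zpow_mul, key i k (by omega), ← zpow_mul, mul_comm, zpow_mul, key j (k + 1) (by omega),
    ← zpow_mul, mul_comm]

theorem alphaFun_mul_left (f g h : diagGroup n ℓ) :
    alphaFun hn hℓ hζ (f * g) h = alphaFun hn hℓ hζ f h * alphaFun hn hℓ hζ g h := by
  have hζ0 : ζ ≠ 0 := hζ.ne_zero (by omega)
  obtain ⟨a, rfl⟩ := exists_word hn hℓ hζ f
  obtain ⟨b, rfl⟩ := exists_word hn hℓ hζ g
  obtain ⟨c, rfl⟩ := exists_word hn hℓ hζ h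
  apply Units.ext
  rw [Units.val_mul, ← word_add, alphaFun_word, alphaFun_word, alphaFun_word, ← zpow_add₀ hζ0]
  simp only [Pi.add_apply, add_mul, Finset.sum_add_distrib, neg_add]

theorem alphaFun_mul_right (f g h : diagGroup n ℓ) :
    alphaFun hn hℓ hζ f (g * h) = alphaFun hn hℓ hζ f g * alphaFun hn hℓ hζ f h := by
  have hζ0 : ζ ≠ 0 := hζ.ne_zero (by omega)
  obtain ⟨a, rfl⟩ := exists_word hn hℓ hζ f
  obtain ⟨b, rfl⟩ := exists_word hn hℓ hζ g
  obtain ⟨c, rfl⟩ := exists_word hn hℓ hζ h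
  apply Units.ext
  rw [Units.val_mul, ← word_add, alphaFun_word, alphaFun_word, alphaFun_word, ← zpow_add₀ hζ0]
  simp only [Pi.add_apply, mul_add, Finset.sum_add_distrib, neg_add]

/-- The 2-cocycle `α` of the group. -/
def alpha : TwoCocycle (diagGroup n ℓ) where
  toFun := alphaFun hn hℓ hζ
  cocycle f g h := by
    rw [alphaFun_mul_left, alphaFun_mul_right]
    rw [← mul_assoc, mul_comm]
  one_left g := by
    simpa using alphaFun_mul_left hn hℓ hζ 1 1 g
  one_right g := by
    simpa using alphaFun_mul_right hn hℓ hζ g 1 1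

end Cocycle

/-! ### The tensor algebra with its group action -/

/-- The tensor algebra `TV` of `V = ℂ^n`. -/
abbrev TV (n : ℕ) : Type := TensorAlgebra ℂ (Fin n → ℂ)

/-- The endomorphism of `TV` induced by the linear action of a matrix on `V`. -/
def actHom (n ℓ : ℕ) : diagGroup n ℓ →* (TV n →ₐ[ℂ] TV n) where
  toFun g := TensorAlgebra.lift ℂ ((TensorAlgebra.ι ℂ).comp (Matrix.toLin' g.1.1))
  map_one' := by
    apply TensorAlgebra.hom_ext
    ext i
    simp
  map_mul' g h := by
    apply TensorAlgebra.hom_ext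
    refine LinearMap.ext fun v => ?_
    simp [Matrix.mulVec_mulVec]

/-- The action of the group on `TV` by algebra automorphisms. -/
def act (n ℓ : ℕ) : diagGroup n ℓ →* (TV n ≃ₐ[ℂ] TV n) :=
  (AlgEquiv.algHomUnitsEquiv ℂ (TV n)).toMonoidHom.comp (actHom n ℓ).toHomUnits

theorem act_ι (n ℓ : ℕ) (g : diagGroup n ℓ) (v : Fin n → ℂ) :
    act n ℓ g (TensorAlgebra.ι ℂ v) = TensorAlgebra.ι ℂ (Matrix.mulVec g.1.1 v) := by
  change actHom n ℓ g (TensorAlgebra.ι ℂ v) = _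
  simp [actHom]

/-! ### The twisted graded Hecke algebra -/

section Hecke

variable {n ℓ : ℕ} [NeZero n] (hn : 3 ≤ n) (hℓ : 2 ≤ ℓ) {ζ : ℂ} (hζ : IsPrimitiveRoot ζ ℓ)

/-- The crossed product `TV #_α G`. -/
abbrev TVG : Type := CrossedProduct (act n ℓ) (alpha hn hℓ hζ)

/-- The basis vector `x_i` of `V`, as the element `x_i ⊗ 1` of `TV #_α G`. -/
def xT (i : Fin n) : TVG hn hℓ hζ :=
  CrossedProduct.tmul _ _ (TensorAlgebra.ι ℂ (Pi.single i 1)) 1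

/-- A group element `g`, as the element `1 ⊗ g` of `TV #_α G`. -/
def gT (g : diagGroup n ℓ) : TVG hn hℓ hζ := CrossedProduct.tmul _ _ 1 g

/-- Cyclic adjacency of indices. -/
def Adjacent (i j : Fin n) : Prop := j = i + 1 ∨ i = j + 1

/-- The defining relations of the twisted graded Hecke algebra. -/
inductive Rel (t : Fin n → ℂ) : TVG hn hℓ hζ → TVG hn hℓ hζ → Prop
  | adjacent (i : Fin n) :
      Rel t (xT hn hℓ hζ i * xT hn hℓ hζ (i + 1) - xT hn hℓ hζ (i + 1) * xT hn hℓ hζ i)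
        (t i • gT hn hℓ hζ (gen hn hℓ hζ i))
  | nonadjacent (i j : Fin n) (hij : ¬ Adjacent i j) :
      Rel t (xT hn hℓ hζ i * xT hn hℓ hζ j - xT hn hℓ hζ j * xT hn hℓ hζ i) 0

/-- The twisted graded Hecke algebra `H`. -/
def Hecke (t : Fin n → ℂ) : Type := RingQuot (Rel hn hℓ hζ t)

instance (t : Fin n → ℂ) : Ring (Hecke hn hℓ hζ t) :=
  inferInstanceAs (Ring (RingQuot (Rel hn hℓ hζ t)))

instance (t : Fin n → ℂ) : Algebra ℂ (Hecke hn hℓ hζ t) :=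
  inferInstanceAs (Algebra ℂ (RingQuot (Rel hn hℓ hζ t)))

variable (t : Fin n → ℂ)

/-- The quotient map `TV #_α G → H`. -/
def Hecke.mk : TVG hn hℓ hζ →ₐ[ℂ] Hecke hn hℓ hζ t := RingQuot.mkAlgHom ℂ (Rel hn hℓ hζ t)

/-- The generator `x_i` of `H`. -/
def Hecke.x (i : Fin n) : Hecke hn hℓ hζ t := Hecke.mk hn hℓ hζ t (xT hn hℓ hζ i)

/-- The generator `g_i`, as an element of `H`. -/
def Hecke.g (i : Fin n) : Hecke hn hℓ hζ t := Hecke.mk hn hℓ hζ t (gT hn hℓ hζ (gen hn hℓ hζ i))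

/-- The index sets without two cyclically adjacent elements. -/
def nonadjacentSets (n : ℕ) [NeZero n] : Finset (Finset (Fin n)) :=
  open Classical in
  Finset.univ.filter fun S => ∀ i ∈ S, ∀ j ∈ S, ¬ Adjacent i j

/-- `δ = (1, …, 1)`. -/
def delta (n : ℕ) : Fin n → ℤ := fun _ => 1

/-- `ε_i`, with entries `1` at `i` and (cyclically) `i + 1`, and `0` elsewhere. -/
def eps {n : ℕ} [NeZero n] (i : Fin n) : Fin n → ℤ := Pi.single i 1 + Pi.single (i + 1) 1

/-- The exponents that occur in `w` are nonnegative. -/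
theorem exponent_nonneg {S : Finset (Fin n)} (hS : S ∈ nonadjacentSets n) (j : Fin n) :
    0 ≤ (delta n - ∑ i ∈ S, eps i) j := by
  have hS' : ∀ i ∈ S, ∀ j ∈ S, ¬ Adjacent i j := by
    simpa [nonadjacentSets] using hS
  have h1 : (∑ i ∈ S, eps i) j = (if j ∈ S then 1 else 0) + (if j - 1 ∈ S then 1 else 0) := by
    simp only [Finset.sum_apply, eps, Pi.add_apply, Finset.sum_add_distrib, Pi.single_apply]
    simp [← sub_eq_iff_eq_add]
  rw [Pi.sub_apply, h1, delta]
  by_cases ha : j ∈ S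
  · by_cases hb : j - 1 ∈ S
    · exact absurd (Or.inl (by simp)) (hS' _ hb _ ha)
    · simp [ha, hb]
  · split_ifs <;> simp

/-- `x^p = x_1^{p_1} ⋯ x_n^{p_n}`, the factors in increasing order, for an exponent vector
`p` with nonnegative entries. -/
def Hecke.xpow (p : Fin n → ℤ) : Hecke hn hℓ hζ t :=
  (List.ofFn fun j => Hecke.x hn hℓ hζ t j ^ (p j).toNat).prod

/-- `τ_i = t_i / (ζ - 1)` for `i < n`, and `τ_n = ζ t_n / (ζ - 1)`; the last index is
`n - 1` here. -/
def tau (ζ : ℂ) (t : Fin n → ℂ) (i : Fin n) : ℂ :=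
  if i.val = n - 1 then ζ * t i / (ζ - 1) else t i / (ζ - 1)

/-- The element `w` of `H`. -/
def Hecke.w : Hecke hn hℓ hζ t :=
  ∑ S ∈ nonadjacentSets n, (∏ i ∈ S, tau ζ t i) •
    (Hecke.xpow hn hℓ hζ t (delta n - ∑ i ∈ S, eps i) *
      ((S.sort (· ≤ ·)).map (Hecke.g hn hℓ hζ t)).prod)

end Hecke

end HomocyclicHecke

end

/-!
The Hecke algebra embeds into the quantum torus `ℂ[z₁^±¹, …, zₙ^±¹] #_α G` by
`x_i ↦ z_i + b_i` with `b_i = -(t_{i-1} / (ζ - 1)) z_{i-1}⁻¹ g_{i-1}`. The commutator pairing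
`α(h, g_i) / α(g_i, h)` equals `χ_i(h) χ_{i+1}(h)`, where `χ_j(h)` is the `j`-th diagonal entry;
hence the `b_i` commute with each other and are rescaled by `G` exactly like the `z_i`. Since `z_i`
is the leading term of `x_i`, the ordered monomials `x^p g` have distinct leading terms `z^p g`, so
they are linearly independent and the representation is faithful.

In the quantum torus, `w` becomes `z₁ ⋯ zₙ + b₁ ⋯ bₙ`: expanding all products over the set `T` of
positions where `z_i` is chosen, the alternating sum over the index sets `S ∈ J` of `w` cancels
unless `T` is empty or everything. Both terms are scalar multiples of `(z₁ ⋯ zₙ)^±¹`, which are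
central.

Conversely, if `z^p g` is a leading term of a central element, commuting with the `x_i` gives
`g = 1` and commuting with `G` gives `p_i ≡ p_{i+1} mod ℓ`. Such a `z^p` is also the leading term of
a product of powers of `x₁^ℓ, …, xₙ^ℓ` and `w`, and one descends on the degree.
-/

noncomputable section

namespace HomocyclicHecke

/-! ### Ordered products -/

section OrderedProducts

variable {M : Type*} [Monoid M] {k : ℕ}

theorem commute_prod_ofFn {c : M} {m : Fin k → M} (h : ∀ j, Commute c (m j)) :
    Commute c (List.ofFn m).prod := by
  refine Commute.list_prod_right _ _ fun x hx => ?_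
  obtain ⟨j, rfl⟩ := List.mem_ofFn.1 hx
  exact h j

theorem prod_ofFn_mul_prod_ofFn (p q : Fin k → M) (h : ∀ i j, i < j → Commute (q i) (p j)) :
    (List.ofFn p).prod * (List.ofFn q).prod = (List.ofFn fun j => p j * q j).prod := by
  induction k with
  | zero => simp
  | succ k ih =>
    have hq : Commute (q 0) (List.ofFn fun j : Fin k => p j.succ).prod :=
      commute_prod_ofFn fun j => h _ _ (Fin.succ_pos j)
    simp only [List.ofFn_succ, List.prod_cons]
    rw [← ih (fun j => p j.succ) (fun j => q j.succ)
      fun i j hij => h _ _ (Fin.succ_lt_succ_iff.2 hij), mul_assoc, mul_assoc,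
      ← mul_assoc _ (q 0), ← hq.eq, mul_assoc]

theorem prod_map_sort (S : Finset (Fin k)) (f : Fin k → M) :
    ((S.sort (· ≤ ·)).map f).prod = (List.ofFn fun j => if j ∈ S then f j else 1).prod := by
  have hsort : S.sort (· ≤ ·) = (List.finRange k).filter (· ∈ S) := by
    refine List.Perm.eq_of_pairwise' (r := (· ≤ ·)) (Finset.pairwise_sort _ _)
      ((List.pairwise_le_finRange k).filter _) ?_
    rw [List.perm_ext_iff_of_nodup (Finset.sort_nodup _ _) ((List.nodup_finRange k).filter _)]
    simp
  rw [hsort, List.ofFn_eq_map]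
  induction List.finRange k with
  | nil => rfl
  | cons a l ih => by_cases ha : a ∈ S <;> simp [ha, ih]

variable [HasDistribNeg M] {m m' : Fin k → M}

theorem prod_ofFn_eq_neg_of_adjacent {i : ℕ} (hi : i + 1 < k)
    (heq : ∀ j : Fin k, j.val ≠ i → j.val ≠ i + 1 → m j = m' j)
    (hneg : m ⟨i, by omega⟩ * m ⟨i + 1, hi⟩ = -(m' ⟨i, by omega⟩ * m' ⟨i + 1, hi⟩)) :
    (List.ofFn m).prod = -(List.ofFn m').prod := by
  induction i generalizing k with
  | zero =>
    obtain ⟨k, rfl⟩ : ∃ r, k = r + 2 := ⟨k - 2, by omega⟩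
    have htail : (fun j : Fin k => m j.succ.succ) = fun j => m' j.succ.succ :=
      funext fun j => heq _ (by simp) (by simp)
    simp only [List.ofFn_succ, List.prod_cons, ← mul_assoc, htail]
    rw [← neg_mul]
    exact congrArg (· * _) hneg
  | succ i ih =>
    obtain ⟨k, rfl⟩ : ∃ r, k = r + 1 := ⟨k - 1, by omega⟩
    rw [List.ofFn_succ, List.prod_cons, List.ofFn_succ, List.prod_cons, heq 0 (by simp) (by simp),
      ih (m := fun j => m j.succ) (m' := fun j => m' j.succ) (by omega)
        (fun j hj hj' => heq _ (by simpa using hj) (by simpa using hj')) hneg, mul_neg]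

theorem prod_ofFn_eq_neg_of_ends (hk : 2 ≤ k)
    (heq : ∀ j : Fin k, j.val ≠ 0 → j.val ≠ k - 1 → m j = m' j)
    (hcomm : ∀ j : Fin k, j.val ≠ 0 → j.val ≠ k - 1 →
      Commute (m ⟨0, by omega⟩) (m' j) ∧ Commute (m' ⟨0, by omega⟩) (m' j))
    (hneg : m ⟨0, by omega⟩ * m ⟨k - 1, by omega⟩ = -(m' ⟨0, by omega⟩ * m' ⟨k - 1, by omega⟩)) :
    (List.ofFn m).prod = -(List.ofFn m').prod := by
  obtain ⟨k, rfl⟩ : ∃ r, k = r + 2 := ⟨k - 2, by omega⟩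
  have hne (j : Fin k) : j.castSucc.succ.val ≠ 0 ∧ j.castSucc.succ.val ≠ k + 2 - 1 := by
    have := j.2
    simp only [Fin.val_succ, Fin.val_castSucc]
    omega
  have hmiddle : (fun j : Fin k => m j.castSucc.succ) = fun j => m' j.castSucc.succ :=
    funext fun j => heq _ (hne j).1 (hne j).2
  have hprod (u : Fin (k + 2) → M) (hu : ∀ j : Fin k, Commute (u 0) (m' j.castSucc.succ))
      (humid : (fun j : Fin k => u j.castSucc.succ) = fun j => m' j.castSucc.succ) :
      (List.ofFn u).prod
        = (List.ofFn fun j : Fin k => m' j.castSucc.succ).prod * (u 0 * u (Fin.last k).succ) := by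
    rw [List.ofFn_succ, List.prod_cons, List.ofFn_succ', List.prod_concat, humid, ← mul_assoc,
      (commute_prod_ofFn hu).eq, mul_assoc]
  rw [hprod m (fun j => (hcomm _ (hne j).1 (hne j).2).1) hmiddle,
    hprod m' (fun j => (hcomm _ (hne j).1 (hne j).2).2) rfl, ← mul_neg]
  exact congrArg (_ * ·) hneg

end OrderedProducts

section Generators

variable {R A : Type*} [CommSemiring R] [Semiring A] [Algebra R A] {s : Set A}

theorem submodule_eq_top_of_adjoin_eq_top (hs : Algebra.adjoin R s = ⊤) {N : Submodule R A}
    (one_mem : 1 ∈ N) (mul_mem : ∀ a ∈ s, ∀ y ∈ N, a * y ∈ N) : N = ⊤ := by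
  have h : ∀ a ∈ Algebra.adjoin R s, ∀ y ∈ N, a * y ∈ N := fun a ha => by
    induction ha using Algebra.adjoin_induction with
    | mem a ha => exact mul_mem a ha
    | algebraMap r => exact fun y hy => by rw [← Algebra.smul_def]; exact N.smul_mem r hy
    | add a b _ _ ha hb => exact fun y hy => by rw [add_mul]; exact N.add_mem (ha y hy) (hb y hy)
    | mul a b _ _ ha hb => exact fun y hy => by rw [mul_assoc]; exact ha _ (hb y hy)
  refine N.eq_top_iff'.2 fun a => mul_one a ▸ h a ?_ 1 one_mem
  rw [hs]
  trivial

theorem mem_center_of_adjoin_eq_top (hs : Algebra.adjoin R s = ⊤) {y : A}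
    (hy : ∀ a ∈ s, Commute a y) : y ∈ Subalgebra.center R A := by
  have hle : Algebra.adjoin R s ≤ Subalgebra.centralizer R {y} :=
    Algebra.adjoin_le fun a ha => by
      rw [SetLike.mem_coe, Subalgebra.mem_centralizer_iff]
      rintro _ rfl
      exact (hy a ha).symm
  rw [hs] at hle
  refine Subalgebra.mem_center_iff.2 fun a => ?_
  exact ((Subalgebra.mem_centralizer_iff R).1 (hle (trivial : a ∈ ⊤)) y rfl).symm

end Generators

section QCommutation

variable {R A : Type*} [CommSemiring R] [Semiring A] [Algebra R A] {x y g : A} {c q : R}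

theorem mul_pow_succ_of_q_commute (hyx : y * x = x * y + c • g) (hgx : g * x = q • (x * g))
    (k : ℕ) :
    y * x ^ (k + 1) = x ^ (k + 1) * y + (c * ∑ m ∈ Finset.range (k + 1), q ^ m) • (x ^ k * g) := by
  induction k with
  | zero => simp [hyx]
  | succ k ih =>
    rw [pow_succ x (k + 1), ← mul_assoc, ih, add_mul, smul_mul_assoc, mul_assoc (x ^ k), hgx,
      mul_assoc, hyx, mul_add, mul_smul_comm, mul_smul_comm, smul_smul, ← mul_assoc (x ^ k),
      ← pow_succ, ← mul_assoc, add_assoc, ← add_smul, geom_sum_succ (n := k + 1)]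
    congr 2
    ring

theorem commute_pow_of_geom_sum_eq_zero (hyx : y * x = x * y + c • g)
    (hgx : g * x = q • (x * g)) {k : ℕ} (hq : ∑ m ∈ Finset.range k, q ^ m = 0) :
    Commute y (x ^ k) := by
  cases k with
  | zero => simp
  | succ k =>
    rw [Commute, SemiconjBy, mul_pow_succ_of_q_commute hyx hgx, hq, mul_zero, zero_smul, add_zero]

end QCommutation

namespace CrossedProduct

variable {G E B : Type*} [Group G] [Ring E] [Algebra ℂ E] [Ring B] [Algebra ℂ B]
  {ρ : G →* (E ≃ₐ[ℂ] E)} {α : TwoCocycle G}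

variable (ρ α) in
/-- The inclusion `r ↦ r ⊗ 1` of the coefficient algebra. -/
def incl : E →ₐ[ℂ] CrossedProduct ρ α :=
  AlgHom.ofLinearMap (Finsupp.lsingle 1 : E →ₗ[ℂ] G →₀ E) rfl fun r s => by
    change tmul ρ α (r * s) 1 = tmul ρ α r 1 * tmul ρ α s 1
    simp [tmul_mul_tmul, α.one_left]

theorem incl_apply (r : E) : incl ρ α r = tmul ρ α r 1 := rfl

theorem tmul_eq_incl_mul (r : E) (g : G) : tmul ρ α r g = incl ρ α r * tmul ρ α 1 g := by
  simp [incl_apply, tmul_mul_tmul, α.one_left]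

/-- The linear map `r ⊗ g ↦ φ r * u g`, which underlies `CrossedProduct.lift`. -/
def liftLinear (φ : E →ₐ[ℂ] B) (u : G → B) : CrossedProduct ρ α →ₗ[ℂ] B :=
  (Finsupp.lsum ℂ fun g => (LinearMap.mulRight ℂ (u g)).comp φ.toLinearMap : (G →₀ E) →ₗ[ℂ] B)

theorem liftLinear_tmul (φ : E →ₐ[ℂ] B) (u : G → B) (r : E) (g : G) :
    liftLinear φ u (tmul ρ α r g) = φ r * u g :=
  (Finsupp.lsum_single ℂ _ g r).trans rfl

theorem liftLinear_mul {φ : E →ₐ[ℂ] B} {u : G → B}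
    (map_mul : ∀ g h, u g * u h = (α.toFun g h : ℂ) • u (g * h))
    (map_act : ∀ g s, u g * φ s = φ (ρ g s) * u g) (a b : CrossedProduct ρ α) :
    liftLinear φ u (a * b) = liftLinear φ u a * liftLinear φ u b := by
  induction a using CrossedProduct.induction with
  | zero => simp
  | add a a' h h' => simp only [add_mul, map_add, h, h']
  | tmul r g =>
  induction b using CrossedProduct.induction with
  | zero => simp
  | add a a' h h' => simp only [mul_add, map_add, h, h']
  | tmul s h =>
    calc liftLinear φ u (tmul ρ α r g * tmul ρ α s h)
      _ = φ r * φ (ρ g s) * ((α.toFun g h : ℂ) • u (g * h)) := by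
        rw [tmul_mul_tmul, liftLinear_tmul, map_smul, _root_.map_mul, smul_mul_assoc,
          mul_smul_comm]
      _ = φ r * (φ (ρ g s) * u g) * u h := by rw [← map_mul, mul_assoc, mul_assoc, mul_assoc]
      _ = φ r * (u g * φ s) * u h := by rw [map_act]
      _ = liftLinear φ u (tmul ρ α r g) * liftLinear φ u (tmul ρ α s h) := by
        simp only [liftLinear_tmul, mul_assoc]

/-- The universal property of the crossed product: an algebra homomorphism on `E` and a
`α`-projective representation of `G` that implements the action of `G` on `E`. -/
def lift (φ : E →ₐ[ℂ] B) (u : G → B) (map_one : u 1 = 1)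
    (map_mul : ∀ g h, u g * u h = (α.toFun g h : ℂ) • u (g * h))
    (map_act : ∀ g s, u g * φ s = φ (ρ g s) * u g) : CrossedProduct ρ α →ₐ[ℂ] B :=
  AlgHom.ofLinearMap (liftLinear φ u)
    (by rw [one_def, liftLinear_tmul, map_one, _root_.map_one, mul_one])
    (liftLinear_mul map_mul map_act)

theorem lift_tmul (φ : E →ₐ[ℂ] B) (u : G → B) (map_one : u 1 = 1)
    (map_mul : ∀ g h, u g * u h = (α.toFun g h : ℂ) • u (g * h))
    (map_act : ∀ g s, u g * φ s = φ (ρ g s) * u g) (r : E) (g : G) :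
    lift (ρ := ρ) φ u map_one map_mul map_act (tmul ρ α r g) = φ r * u g :=
  liftLinear_tmul φ u r g

end CrossedProduct

/-- The twisted group algebra `ℂ_α M`, with basis `M` and product `a * b = α(a, b) ab`: the
crossed product of `M` with `ℂ` for the trivial action. -/
abbrev TwistedGroupAlgebra {M : Type*} [Group M] (α : TwoCocycle M) : Type _ :=
  CrossedProduct (1 : M →* (ℂ ≃ₐ[ℂ] ℂ)) α

namespace TwistedGroupAlgebra

variable {M : Type*} [Group M] {α : TwoCocycle M}

variable (α) in
/-- The basis element of the twisted group algebra attached to a group element. -/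
def of (a : M) : TwistedGroupAlgebra α := CrossedProduct.tmul 1 α 1 a

theorem of_one : of α 1 = 1 := rfl

theorem of_mul_of (a b : M) : of α a * of α b = (α.toFun a b : ℂ) • of α (a * b) := by
  simp only [of, CrossedProduct.tmul_mul_tmul, CrossedProduct.smul_tmul, map_one, mul_one]

theorem tmul_eq_smul_of (c : ℂ) (a : M) : CrossedProduct.tmul 1 α c a = c • of α a := by
  simp only [of, CrossedProduct.smul_tmul, smul_eq_mul, mul_one]

@[elab_as_elim]
theorem induction {p : TwistedGroupAlgebra α → Prop} (f : TwistedGroupAlgebra α) (zero : p 0)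
    (add : ∀ f h, p f → p h → p (f + h)) (smul_of : ∀ (c : ℂ) a, p (c • of α a)) : p f :=
  CrossedProduct.induction f zero add fun c a => tmul_eq_smul_of c a ▸ smul_of c a

/-- The coefficient of a group element in an element of the twisted group algebra. -/
def coeff (a : M) : TwistedGroupAlgebra α →ₗ[ℂ] ℂ := (Finsupp.lapply a : (M →₀ ℂ) →ₗ[ℂ] ℂ)

/-- The group elements that occur in an element of the twisted group algebra. -/
def support (f : TwistedGroupAlgebra α) : Finset M := Finsupp.support f

theorem mem_support {f : TwistedGroupAlgebra α} {a : M} : a ∈ support f ↔ coeff a f ≠ 0 :=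
  Finsupp.mem_support_iff

open Classical in
theorem coeff_of (a b : M) : coeff b (of α a) = if a = b then 1 else 0 :=
  Finsupp.single_apply

theorem coeff_of_mul (a b : M) (f : TwistedGroupAlgebra α) :
    coeff (a * b) (of α a * f) = α.toFun a b * coeff b f := by
  induction f using TwistedGroupAlgebra.induction with
  | zero => simp
  | add f h hf hh => simp only [mul_add, map_add, hf, hh]
  | smul_of c e =>
    simp only [mul_smul_comm, of_mul_of, map_smul, coeff_of, smul_eq_mul]
    by_cases h : e = b
    · subst h; simp [mul_comm]
    · simp [h]

theorem coeff_mul_of (a b : M) (f : TwistedGroupAlgebra α) :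
    coeff (a * b) (f * of α b) = α.toFun a b * coeff a f := by
  induction f using TwistedGroupAlgebra.induction with
  | zero => simp
  | add f h hf hh => simp only [add_mul, mul_add, map_add, hf, hh]
  | smul_of c e =>
    simp only [smul_mul_assoc, of_mul_of, map_smul, coeff_of, smul_eq_mul]
    by_cases h : e = a
    · subst h; simp [mul_comm]
    · simp [h]

theorem commute_of {a : M} (ha : ∀ b, Commute a b) (hα : ∀ b, α.toFun a b = α.toFun b a)
    (f : TwistedGroupAlgebra α) : Commute (of α a) f := by
  induction f using TwistedGroupAlgebra.induction with
  | zero => exact Commute.zero_right _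
  | add f h hf hh => exact hf.add_right hh
  | smul_of c b =>
    refine Commute.smul_right ?_ c
    rw [Commute, SemiconjBy, of_mul_of, of_mul_of, hα b, (ha b).eq]

theorem exists_prod_ofFn_smul_of {n : ℕ} (c : Fin n → ℂ) (a : Fin n → M) :
    ∃ e : ℂ, (List.ofFn fun j => c j • of α (a j)).prod = e • of α (List.ofFn a).prod := by
  induction n with
  | zero => exact ⟨1, by simp [of_one]⟩
  | succ n ih =>
    obtain ⟨e, he⟩ := ih (fun j => c j.succ) (fun j => a j.succ)
    exact ⟨c 0 * e * α.toFun (a 0) (List.ofFn fun j => a j.succ).prod, by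
      simp only [List.ofFn_succ, List.prod_cons, he, smul_mul_assoc, mul_smul_comm, of_mul_of,
        smul_smul, mul_assoc, mul_left_comm]⟩

section Degree

variable (α) (deg : M → ℤ)

/-- The span of the basis elements of degree less than `d`. -/
def degLT (d : ℤ) : Submodule ℂ (TwistedGroupAlgebra α) :=
  (Finsupp.supported ℂ ℂ {a | deg a < d} : Submodule ℂ (M →₀ ℂ))

theorem degLT_eq_span (d : ℤ) : degLT α deg d = Submodule.span ℂ (of α '' {a | deg a < d}) :=
  Finsupp.supported_eq_span_single ℂ _

variable {α deg}

theorem mem_degLT {d : ℤ} {f : TwistedGroupAlgebra α} :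
    f ∈ degLT α deg d ↔ ∀ a, d ≤ deg a → coeff a f = 0 :=
  (Finsupp.mem_supported' ℂ _).trans (by simp only [Set.mem_ofPred_eq, not_lt]; rfl)

theorem degLT_mono {d e : ℤ} (h : d ≤ e) : degLT α deg d ≤ degLT α deg e :=
  fun _ hf => mem_degLT.2 fun a ha => mem_degLT.1 hf a (h.trans ha)

theorem of_mem_degLT {d : ℤ} {a : M} (h : deg a < d) : of α a ∈ degLT α deg d := by
  rw [degLT_eq_span]
  exact Submodule.subset_span ⟨a, h, rfl⟩

theorem mul_mem_degLT (hdeg : ∀ a b, deg (a * b) = deg a + deg b) {d e : ℤ}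
    {f h : TwistedGroupAlgebra α} (hf : f ∈ degLT α deg d) (hh : h ∈ degLT α deg e) :
    f * h ∈ degLT α deg (d + e - 1) := by
  suffices degLT α deg d * degLT α deg e ≤ degLT α deg (d + e - 1) from
    this (Submodule.mul_mem_mul hf hh)
  rw [degLT_eq_span, degLT_eq_span, Submodule.span_mul_span, Submodule.span_le]
  rintro _ ⟨_, ⟨a, ha : deg a < d, rfl⟩, _, ⟨b, hb : deg b < e, rfl⟩, rfl⟩
  dsimp only
  rw [of_mul_of]
  exact Submodule.smul_mem _ _ (of_mem_degLT (by rw [hdeg]; omega))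

variable (deg) in
theorem exists_mem_degLT (f : TwistedGroupAlgebra α) : ∃ d : ℕ, f ∈ degLT α deg d := by
  induction f using TwistedGroupAlgebra.induction with
  | zero => exact ⟨0, zero_mem _⟩
  | add f h hf hh =>
    obtain ⟨d, hd⟩ := hf
    obtain ⟨e, he⟩ := hh
    exact ⟨max d e, add_mem (degLT_mono (by simp) hd) (degLT_mono (by simp) he)⟩
  | smul_of c a =>
    exact ⟨(deg a + 1).toNat, Submodule.smul_mem _ _ (of_mem_degLT (by omega))⟩

variable (deg) in
/-- `f` has leading term `a`: it is monic, and `a` is its only term of top degree. -/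
def HasLead (a : M) (f : TwistedGroupAlgebra α) : Prop := f - of α a ∈ degLT α deg (deg a)

theorem hasLead_of (a : M) : HasLead deg a (of α a) := by simp [HasLead]

theorem HasLead.mem_degLT {a : M} {f : TwistedGroupAlgebra α} (hf : HasLead deg a f) :
    f ∈ degLT α deg (deg a + 1) := by
  rw [← sub_add_cancel f (of α a)]
  exact add_mem (degLT_mono (by omega) hf) (of_mem_degLT (by omega))

open Classical in
theorem HasLead.coeff_eq {a b : M} {f : TwistedGroupAlgebra α} (hf : HasLead deg a f)
    (hab : deg a ≤ deg b) : coeff b f = if a = b then 1 else 0 := by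
  have h : coeff b (f - of α a) = 0 := TwistedGroupAlgebra.mem_degLT.1 hf b hab
  rwa [map_sub, coeff_of, sub_eq_zero] at h

theorem HasLead.mul (hdeg : ∀ a b, deg (a * b) = deg a + deg b) {a b : M}
    {f h : TwistedGroupAlgebra α} (hf : HasLead deg a f) (hh : HasLead deg b h)
    (hab : α.toFun a b = 1) : HasLead deg (a * b) (f * h) := by
  have hof : of α (a * b) = of α a * of α b := by rw [of_mul_of, hab, Units.val_one, one_smul]
  have hsplit : f * h - of α (a * b) = (f - of α a) * h + of α a * (h - of α b) := by
    rw [hof]; noncomm_ring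
  rw [HasLead, hsplit, hdeg]
  have ha : of α a ∈ degLT α deg (deg a + 1) := (hasLead_of a).mem_degLT
  exact add_mem (degLT_mono (by omega) (mul_mem_degLT hdeg hf hh.mem_degLT))
    (degLT_mono (by omega) (mul_mem_degLT hdeg ha hh))

theorem HasLead.coeff_mul (hdeg : ∀ a b, deg (a * b) = deg a + deg b) {a b : M}
    {u f : TwistedGroupAlgebra α} (hu : HasLead deg a u) (hf : f ∈ degLT α deg (deg b + 1)) :
    coeff (a * b) (u * f) = α.toFun a b * coeff b f := by
  have hlow : coeff (a * b) ((u - of α a) * f) = 0 :=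
    TwistedGroupAlgebra.mem_degLT.1 (mul_mem_degLT hdeg hu hf) _ (by rw [hdeg]; omega)
  rwa [sub_mul, map_sub, coeff_of_mul, sub_eq_zero] at hlow

theorem HasLead.coeff_mul_right (hdeg : ∀ a b, deg (a * b) = deg a + deg b) {a b : M}
    {u f : TwistedGroupAlgebra α} (hu : HasLead deg b u) (hf : f ∈ degLT α deg (deg a + 1)) :
    coeff (a * b) (f * u) = α.toFun a b * coeff a f := by
  have hlow : coeff (a * b) (f * (u - of α b)) = 0 :=
    TwistedGroupAlgebra.mem_degLT.1 (mul_mem_degLT hdeg hf hu) _ (by rw [hdeg]; omega)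
  rwa [mul_sub, map_sub, coeff_mul_of, sub_eq_zero] at hlow

theorem HasLead.toFun_swap_of_commute (hdeg : ∀ a b, deg (a * b) = deg a + deg b) {a b : M}
    (hab : Commute a b) {u f : TwistedGroupAlgebra α} (hu : HasLead deg a u)
    (hf : f ∈ degLT α deg (deg b + 1)) (hb : coeff b f ≠ 0) (huf : Commute u f) :
    α.toFun a b = α.toFun b a := by
  have hcoeff := hu.coeff_mul hdeg hf
  rw [hab.eq, huf.eq, hu.coeff_mul_right hdeg hf] at hcoeff
  exact Units.ext (mul_right_cancel₀ hb hcoeff).symm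

end Degree

section Family

variable {deg : M → ℤ} {ι : Type*} {a : ι → M} {v : ι → TwistedGroupAlgebra α}

theorem coeff_linearCombination (b : M) (c : ι →₀ ℂ) :
    coeff b (Finsupp.linearCombination ℂ v c) = c.sum fun i r => r * coeff b (v i) := by
  rw [Finsupp.linearCombination_apply, map_finsuppSum]
  simp only [map_smul, smul_eq_mul]

theorem eq_zero_of_linearCombination_mem_degLT (hv : ∀ i, HasLead deg (a i) (v i))
    (ha : Function.Injective a) {c : ι →₀ ℂ} {d : ℤ}
    (hc : Finsupp.linearCombination ℂ v c ∈ degLT α deg d) {i : ι} (hi : d ≤ deg (a i)) :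
    c i = 0 := by
  classical
  by_contra hci
  obtain ⟨m, hm, hmax⟩ :=
    c.support.exists_max_image (fun j => deg (a j)) ⟨i, Finsupp.mem_support_iff.2 hci⟩
  have htop : coeff (a m) (Finsupp.linearCombination ℂ v c) = c m := by
    rw [coeff_linearCombination, Finsupp.sum, Finset.sum_eq_single_of_mem m hm]
    · rw [(hv m).coeff_eq le_rfl, if_pos rfl, mul_one]
    · intro j hj hjm
      rw [(hv j).coeff_eq (hmax j hj), if_neg (ha.ne hjm), mul_zero]
  have hdm : d ≤ deg (a m) := hi.trans (hmax i (Finsupp.mem_support_iff.2 hci))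
  exact Finsupp.mem_support_iff.1 hm (htop.symm.trans (mem_degLT.1 hc _ hdm))

theorem exists_eq_of_coeff_linearCombination_ne_zero (hv : ∀ i, HasLead deg (a i) (v i))
    (ha : Function.Injective a) {c : ι →₀ ℂ} {b : M}
    (hc : Finsupp.linearCombination ℂ v c ∈ degLT α deg (deg b + 1))
    (hb : coeff b (Finsupp.linearCombination ℂ v c) ≠ 0) : ∃ i, a i = b := by
  rw [coeff_linearCombination] at hb
  obtain ⟨i, -, hi⟩ := Finset.exists_ne_zero_of_sum_ne_zero hb
  have hle : deg (a i) ≤ deg b := by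
    by_contra! hlt
    exact left_ne_zero_of_mul hi (eq_zero_of_linearCombination_mem_degLT hv ha hc hlt)
  refine ⟨i, by_contra fun hne => right_ne_zero_of_mul hi ?_⟩
  rw [(hv i).coeff_eq hle, if_neg hne]

end Family

section Reduction

variable {deg : M → ℤ} {A C : Submodule ℂ (TwistedGroupAlgebra α)}

theorem exists_sub_mem_degLT {d : ℤ} {f : TwistedGroupAlgebra α} (hf : f ∈ degLT α deg (d + 1))
    (hlead : ∀ b, deg b = d → coeff b f ≠ 0 → ∃ s ∈ A, HasLead deg b s) :
    ∃ r ∈ A, f - r ∈ degLT α deg d := by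
  classical
  have hs : ∀ b, ∃ s ∈ A, deg b = d → coeff b f ≠ 0 → HasLead deg b s := fun b => by
    by_cases hb : deg b = d ∧ coeff b f ≠ 0
    · obtain ⟨s, hs, hbs⟩ := hlead b hb.1 hb.2
      exact ⟨s, hs, fun _ _ => hbs⟩
    · exact ⟨0, zero_mem A, fun h h' => absurd ⟨h, h'⟩ hb⟩
  choose s hsA hs using hs
  let top : Finset M := (support f).filter fun b => deg b = d
  have hmem : ∀ b, b ∈ top ↔ coeff b f ≠ 0 ∧ deg b = d := fun b => by
    simp only [top, Finset.mem_filter, mem_support]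
  refine ⟨∑ b ∈ top, coeff b f • s b, sum_mem fun b _ => Submodule.smul_mem _ _ (hsA b),
    mem_degLT.2 fun b hb => ?_⟩
  have hcoeff : coeff b (∑ i ∈ top, coeff i f • s i) = if b ∈ top then coeff b f else 0 := by
    rw [map_sum, ← Finset.sum_ite_eq' top b fun i => coeff i f]
    refine Finset.sum_congr rfl fun i hi => ?_
    obtain ⟨hif, hid⟩ := (hmem i).1 hi
    rw [map_smul, (hs i hid hif).coeff_eq (hid.trans_le hb), smul_eq_mul, mul_ite, mul_one,
      mul_zero]
  rw [map_sub, hcoeff]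
  split_ifs with hbt
  · exact sub_self _
  · rw [sub_zero]
    by_contra hbf
    have hbd : ¬d + 1 ≤ deg b := fun h => hbf (mem_degLT.1 hf b h)
    exact hbt ((hmem b).2 ⟨hbf, by omega⟩)

theorem le_of_forall_hasLead (hAC : A ≤ C) (hC : ∀ f ∈ C, f ∈ degLT α deg 0 → f = 0)
    (hlead : ∀ f ∈ C, ∀ b, f ∈ degLT α deg (deg b + 1) → coeff b f ≠ 0 →
      ∃ s ∈ A, HasLead deg b s) : C ≤ A := by
  suffices ∀ d : ℕ, ∀ f ∈ C, f ∈ degLT α deg d → f ∈ A by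
    intro f hf
    obtain ⟨d, hd⟩ := exists_mem_degLT deg f
    exact this d f hf hd
  intro d
  induction d with
  | zero =>
    intro f hf hf0
    rw [hC f hf hf0]
    exact zero_mem A
  | succ d ih =>
    intro f hf hfd
    rw [Nat.cast_succ] at hfd
    obtain ⟨r, hrA, hr⟩ := exists_sub_mem_degLT hfd fun b hb hbf =>
      hlead f hf b (by rwa [hb]) hbf
    rw [← sub_add_cancel f r]
    exact add_mem (ih _ (sub_mem hf (hAC hrA)) hr) hrA

end Reduction

end TwistedGroupAlgebra

section Characters

variable {n ℓ : ℕ}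

/-- The `j`-th diagonal entry, as a character of the group. -/
def entry (j : Fin n) : diagGroup n ℓ →* ℂˣ :=
  MonoidHom.toHomUnits
    { toFun := fun g => g.1.1 j j
      map_one' := Matrix.one_apply_eq j
      map_mul' := fun g h => mul_diag g h j }

theorem entry_val (j : Fin n) (g : diagGroup n ℓ) : (entry j g : ℂ) = g.1.1 j j := rfl

theorem eq_of_entry_eq {g h : diagGroup n ℓ} (H : ∀ j, entry j g = entry j h) : g = h :=
  ext_diag fun j => congrArg Units.val (H j)

theorem prod_entry (g : diagGroup n ℓ) : ∏ j, entry j g = 1 := by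
  apply Units.ext
  have hdet : (g.1 : Matrix (Fin n) (Fin n) ℂ).det = 1 := g.1.2
  rw [coe_eq_diagonal, Matrix.det_diagonal] at hdet
  simpa only [Units.coe_prod, entry_val, Units.val_one] using hdet

theorem entry_pow (j : Fin n) (g : diagGroup n ℓ) : entry j g ^ ℓ = 1 := by
  rw [← map_pow, show g ^ ℓ = 1 from Subtype.ext g.2.2, map_one]

/-- The character by which the group acts on the Laurent monomial with exponent `q`. -/
def weight (q : Fin n → ℤ) (g : diagGroup n ℓ) : ℂˣ := ∏ j, entry j g ^ q j

theorem weight_add (p q : Fin n → ℤ) (g : diagGroup n ℓ) :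
    weight (p + q) g = weight p g * weight q g := by
  simp [weight, zpow_add, Finset.prod_mul_distrib]

theorem weight_neg (p : Fin n → ℤ) (g : diagGroup n ℓ) : weight (-p) g = (weight p g)⁻¹ := by
  simp [weight]

theorem weight_mul (p : Fin n → ℤ) (g h : diagGroup n ℓ) :
    weight p (g * h) = weight p g * weight p h := by
  simp [weight, mul_zpow, Finset.prod_mul_distrib]

@[simp] theorem weight_one (p : Fin n → ℤ) : weight p (1 : diagGroup n ℓ) = 1 := by
  simp [weight]

@[simp] theorem weight_zero (g : diagGroup n ℓ) : weight 0 g = 1 := by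
  simp [weight]

theorem weight_single (i : Fin n) (g : diagGroup n ℓ) : weight (Pi.single i 1) g = entry i g := by
  rw [weight, Finset.prod_eq_single i]
  · simp
  · intro j _ hj
    simp [hj]
  · simp

theorem weight_const (k : ℤ) (g : diagGroup n ℓ) : weight (fun _ => k) g = 1 := by
  rw [weight, Finset.prod_zpow, prod_entry, one_zpow]

theorem partialProd_eq_mul_entry {k : ℕ} (hk : k < n) (g : diagGroup n ℓ) :
    partialProd k g = (∏ j : Fin n with j.val < k, (entry j g : ℂ)) * entry ⟨k, hk⟩ g := by
  have hinsert : (Finset.univ.filter fun j : Fin n => j.val ≤ k)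
      = insert ⟨k, hk⟩ (Finset.univ.filter fun j : Fin n => j.val < k) := by
    ext j
    simp only [Finset.mem_filter, Finset.mem_univ, true_and, Finset.mem_insert, Fin.ext_iff]
    omega
  change ∏ j : Fin n with j.val ≤ k, g.1.1 j j = _
  rw [hinsert, Finset.prod_insert (by simp), mul_comm]
  rfl

theorem partialProd_zero (hn : 0 < n) (g : diagGroup n ℓ) : partialProd 0 g = entry ⟨0, hn⟩ g := by
  simp [partialProd_eq_mul_entry hn]

theorem partialProd_succ {k : ℕ} (hk : k + 1 < n) (g : diagGroup n ℓ) :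
    partialProd (k + 1) g = partialProd k g * entry ⟨k + 1, hk⟩ g := by
  simp only [partialProd_eq_mul_entry hk, Nat.lt_succ_iff]
  rfl

theorem partialProd_last (g : diagGroup n ℓ) : partialProd (n - 1) g = 1 := by
  change ∏ j : Fin n with j.val ≤ n - 1, g.1.1 j j = 1
  rw [Finset.filter_true_of_mem fun j _ => by omega]
  exact (Units.coe_prod _ _).symm.trans (congrArg Units.val (prod_entry g))

theorem partialProd_ne_zero (k : ℕ) (g : diagGroup n ℓ) : partialProd k g ≠ 0 :=
  ((partialProd k).toHomUnits g).ne_zero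

end Characters

section CommutatorPairing

variable {n ℓ : ℕ} [NeZero n] {hn : 3 ≤ n} {hℓ : 2 ≤ ℓ} {ζ : ℂ} {hζ : IsPrimitiveRoot ζ ℓ}

theorem entry_gen (i j : Fin n) : (entry j (gen hn hℓ hζ i) : ℂ) = genEntry ζ i j :=
  Matrix.diagonal_apply_eq _ j

theorem prod_gen : ∏ i, gen hn hℓ hζ i = 1 := by
  refine eq_of_entry_eq fun j => Units.ext ?_
  rw [map_prod, map_one, Units.coe_prod]
  simp only [entry_gen, genEntry_eq hn, Finset.prod_mul_distrib]
  simp [← sub_eq_iff_eq_add, hζ.ne_zero (by omega)]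

theorem weight_gen (p : Fin n → ℤ) (i : Fin n) :
    (weight p (gen hn hℓ hζ i) : ℂ) = ζ ^ (p i - p (i + 1)) := by
  have hite : ∀ (P : Prop) [Decidable P] (a : ℂ) (k : ℤ),
      (if P then a else 1) ^ k = if P then a ^ k else 1 := by
    intro P _ a k
    split_ifs <;> simp
  rw [weight, Units.coe_prod]
  simp only [Units.val_zpow_eq_zpow_val, entry_gen, genEntry_eq hn, mul_zpow, hite,
    Finset.prod_mul_distrib, Finset.prod_ite_eq', Finset.mem_univ, if_true]
  rw [sub_eq_add_neg, zpow_add₀ (hζ.ne_zero (by omega)), inv_zpow, zpow_neg]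

theorem word_single {k : ℕ} (hk : k < n - 1) :
    word hn hℓ hζ (Pi.single k 1) = gen hn hℓ hζ ⟨k, by omega⟩ := by
  rw [word, Finset.prod_eq_single_of_mem k (Finset.mem_range.2 hk)]
  · rw [Pi.single_eq_same, zpow_one]
    congr 1
    exact Fin.ext (Nat.mod_eq_of_lt (by omega))
  · intro j _ hj
    simp [hj]

theorem alphaFun_one_left (g : diagGroup n ℓ) : alphaFun hn hℓ hζ 1 g = 1 :=
  (alpha hn hℓ hζ).one_left g

theorem alphaFun_one_right (g : diagGroup n ℓ) : alphaFun hn hℓ hζ g 1 = 1 :=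
  (alpha hn hℓ hζ).one_right g

theorem prod_alphaFun_left {ι : Type*} (s : Finset ι) (f : ι → diagGroup n ℓ)
    (h : diagGroup n ℓ) :
    alphaFun hn hℓ hζ (∏ i ∈ s, f i) h = ∏ i ∈ s, alphaFun hn hℓ hζ (f i) h :=
  map_prod (MonoidHom.mk' (alphaFun hn hℓ hζ · h) fun a b => alphaFun_mul_left hn hℓ hζ a b h) f s

theorem prod_alphaFun_right {ι : Type*} (s : Finset ι) (f : ι → diagGroup n ℓ)
    (h : diagGroup n ℓ) :
    alphaFun hn hℓ hζ h (∏ i ∈ s, f i) = ∏ i ∈ s, alphaFun hn hℓ hζ h (f i) :=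
  map_prod (MonoidHom.mk' (alphaFun hn hℓ hζ h) (alphaFun_mul_right hn hℓ hζ h)) f s

theorem alphaFun_gen_right_mul_partialProd {k : ℕ} (hk : k < n - 1) (h : diagGroup n ℓ) :
    alphaFun hn hℓ hζ h (gen hn hℓ hζ ⟨k, by omega⟩) * partialProd k h = entry ⟨k, by omega⟩ h := by
  obtain ⟨a, ha⟩ := exists_word hn hℓ hζ h
  have hα : (alphaFun hn hℓ hζ h (gen hn hℓ hζ ⟨k, by omega⟩) : ℂ)
      = ζ ^ (-∑ m ∈ Finset.range (n - 2), a m * (Pi.single k 1 : ℕ → ℤ) (m + 1)) := by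
    rw [← word_single hk, ha, alphaFun_word]
  cases k with
  | zero =>
    rw [hα, Finset.sum_eq_zero fun m _ => by simp, neg_zero, zpow_zero, one_mul,
      partialProd_zero]
  | succ k =>
    rw [hα, Finset.sum_eq_single_of_mem k (Finset.mem_range.2 (by omega))
        fun m _ hm => by simp [hm],
      Pi.single_eq_same, mul_one, partialProd_succ (by omega), ← mul_assoc, ha,
      partialProd_word hn hℓ hζ (by omega), zpow_neg,
      inv_mul_cancel₀ (zpow_ne_zero _ (hζ.ne_zero (by omega))), one_mul]

theorem alphaFun_gen_left_mul_partialProd {k : ℕ} (hk : k < n - 1) (h : diagGroup n ℓ) :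
    alphaFun hn hℓ hζ (gen hn hℓ hζ ⟨k, by omega⟩) h * partialProd (k + 1) h = 1 := by
  obtain ⟨a, ha⟩ := exists_word hn hℓ hζ h
  have hα : (alphaFun hn hℓ hζ (gen hn hℓ hζ ⟨k, by omega⟩) h : ℂ)
      = ζ ^ (-∑ m ∈ Finset.range (n - 2), (Pi.single k 1 : ℕ → ℤ) m * a (m + 1)) := by
    rw [← word_single hk, ha, alphaFun_word]
  rcases Nat.lt_or_ge (k + 1) (n - 1) with hk' | hk'
  · rw [hα, Finset.sum_eq_single_of_mem k (Finset.mem_range.2 (by omega))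
        fun m _ hm => by simp [hm],
      Pi.single_eq_same, one_mul, ha, partialProd_word hn hℓ hζ hk', zpow_neg,
      inv_mul_cancel₀ (zpow_ne_zero _ (hζ.ne_zero (by omega)))]
  · have hsum : ∑ m ∈ Finset.range (n - 2), (Pi.single k 1 : ℕ → ℤ) m * a (m + 1) = 0 :=
      Finset.sum_eq_zero fun m hm => by
        rw [Pi.single_eq_of_ne (by have := Finset.mem_range.1 hm; omega), zero_mul]
    rw [hα, hsum, neg_zero, zpow_zero, one_mul, show k + 1 = n - 1 by omega, partialProd_last]

theorem alphaFun_gen_swap_of_lt {k : ℕ} (hk : k < n - 1) (h : diagGroup n ℓ) :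
    alphaFun hn hℓ hζ h (gen hn hℓ hζ ⟨k, by omega⟩)
      = alphaFun hn hℓ hζ (gen hn hℓ hζ ⟨k, by omega⟩) h
        * (entry ⟨k, by omega⟩ h * entry ⟨k + 1, by omega⟩ h) := by
  have hright := alphaFun_gen_right_mul_partialProd (hn := hn) (hℓ := hℓ) (hζ := hζ) hk h
  have hleft := alphaFun_gen_left_mul_partialProd (hn := hn) (hℓ := hℓ) (hζ := hζ) hk h
  rw [partialProd_succ (by omega)] at hleft
  refine Units.ext (mul_right_cancel₀ (partialProd_ne_zero k h) ?_)
  simp only [Units.val_mul]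
  linear_combination hright - (entry ⟨k, _⟩ h : ℂ) * hleft

theorem alphaFun_gen_swap (h : diagGroup n ℓ) (i : Fin n) :
    alphaFun hn hℓ hζ h (gen hn hℓ hζ i)
      = alphaFun hn hℓ hζ (gen hn hℓ hζ i) h * (entry i h * entry (i + 1) h) := by
  let pairing : Fin n → ℂˣ := fun j =>
    alphaFun hn hℓ hζ (gen hn hℓ hζ j) h * (entry j h * entry (j + 1) h)
  have hlt : ∀ j : Fin n, j.val < n - 1 → alphaFun hn hℓ hζ h (gen hn hℓ hζ j) = pairing j := by
    intro j hj
    have hsucc : j + 1 = ⟨j.val + 1, by omega⟩ := Fin.ext (Fin.val_add_one_of_lt' (by omega))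
    simp only [pairing, hsucc]
    exact alphaFun_gen_swap_of_lt hj h
  have hprod : ∏ j, alphaFun hn hℓ hζ h (gen hn hℓ hζ j) = ∏ j, pairing j := by
    have hshift : ∏ j : Fin n, entry (j + 1) h = 1 :=
      (Equiv.prod_comp (Equiv.addRight 1) fun j => entry j h).trans (prod_entry h)
    rw [Finset.prod_mul_distrib, Finset.prod_mul_distrib, ← prod_alphaFun_left,
      ← prod_alphaFun_right, prod_gen, hshift, prod_entry, alphaFun_one_left, alphaFun_one_right,
      mul_one, mul_one]
  -- On the last index the identity follows from the others, since both sides multiply to `1`.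
  by_cases hi : i.val < n - 1
  · exact hlt i hi
  · rw [← Finset.mul_prod_erase _ _ (Finset.mem_univ i), ← Finset.mul_prod_erase _ pairing
      (Finset.mem_univ i), Finset.prod_congr rfl fun j hj => hlt j ?_] at hprod
    · exact mul_right_cancel hprod
    · have := Fin.val_ne_of_ne (Finset.ne_of_mem_erase hj)
      omega

end CommutatorPairing

section Indices

variable {n : ℕ} [NeZero n]

theorem succ_succ_ne (hn : 3 ≤ n) (i : Fin n) : i + 1 + 1 ≠ i := by
  rw [add_assoc, ne_eq, add_eq_left, Fin.ext_iff, Fin.val_add, Fin.val_one', Fin.val_zero,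
    Nat.mod_eq_of_lt (show 1 < n by omega), Nat.mod_eq_of_lt (by omega)]
  omega

theorem genEntry_mul_genEntry (hn : 3 ≤ n) {ζ : ℂ} (hζ0 : ζ ≠ 0) (i j : Fin n) :
    genEntry ζ i (j + 1) * genEntry ζ j i = 1 := by
  rw [genEntry_eq hn, genEntry_eq hn]
  by_cases h : i = j
  · subst h
    simp [succ_ne hn, (succ_ne hn i).symm, hζ0]
  · by_cases h' : i = j + 1
    · subst h'
      have := succ_ne hn (j + 1)
      simp [succ_ne hn, hζ0, this.symm]
    · simp [h, h', Ne.symm h, Ne.symm h']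

theorem genEntry_sub_one_add_one (hn : 3 ≤ n) (ζ : ℂ) (i : Fin n) :
    genEntry ζ (i - 1) (i + 1) = 1 := by
  have h : i + 1 ≠ i - 1 := fun h => succ_succ_ne hn (i - 1) (by rw [sub_add_cancel, h])
  rw [genEntry, if_neg h, if_neg (by rw [sub_add_cancel]; exact succ_ne hn i)]

theorem genEntry_sub_one_of_not_adjacent {ζ : ℂ} {i j : Fin n} (hij : ¬ Adjacent i j)
    (hne : i ≠ j) : genEntry ζ (j - 1) i = 1 := by
  have h : i ≠ j - 1 := fun h => hij (Or.inl (by rw [h, sub_add_cancel]))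
  rw [genEntry, if_neg h, if_neg (by rwa [sub_add_cancel])]

theorem mem_nonadjacentSets {S : Finset (Fin n)} :
    S ∈ nonadjacentSets n ↔ ∀ i ∈ S, i + 1 ∉ S := by
  simp only [nonadjacentSets, Finset.mem_filter, Finset.mem_univ, true_and]
  constructor
  · exact fun h i hi hi' => h i hi _ hi' (Or.inl rfl)
  · rintro h i hi j hj (rfl | rfl)
    · exact h i hi hj
    · exact h j hj hi

/-- The positions `j ∈ T` with `j + 1 ∉ T`. -/
def descents (T : Finset (Fin n)) : Finset (Fin n) := T.filter fun j => j + 1 ∉ T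

theorem mem_descents {T : Finset (Fin n)} {j : Fin n} : j ∈ descents T ↔ j ∈ T ∧ j + 1 ∉ T :=
  Finset.mem_filter

theorem mem_nonadjacentSets_of_subset_descents {S T : Finset (Fin n)} (h : S ⊆ descents T) :
    S ∈ nonadjacentSets n :=
  mem_nonadjacentSets.2 fun _ hi hi' => (mem_descents.1 (h hi)).2 (mem_descents.1 (h hi')).1

theorem cyclic_induction {P : Fin n → Prop} {i : Fin n} (hi : P i) (succ : ∀ j, P j → P (j + 1))
    (j : Fin n) : P j := by
  have add (k : ℕ) : P (i + Fin.ofNat n k) := by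
    induction k with
    | zero => simpa using hi
    | succ k ih =>
      have hk : Fin.ofNat n (k + 1) = Fin.ofNat n k + 1 := Fin.ext (by simp [Fin.val_add])
      rw [hk, ← add_assoc]
      exact succ _ ih
  simpa using add (j - i).val

theorem descents_eq_empty_iff {T : Finset (Fin n)} :
    descents T = ∅ ↔ T = ∅ ∨ T = Finset.univ := by
  constructor
  · refine fun h => T.eq_empty_or_nonempty.imp_right fun ⟨i, hi⟩ => ?_
    refine Finset.eq_univ_iff_forall.2 (cyclic_induction hi fun j hj => ?_)
    by_contra hj'
    exact Finset.notMem_empty j (h ▸ mem_descents.2 ⟨hj, hj'⟩)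
  · rintro (rfl | rfl)
    · rfl
    · ext j
      simp [mem_descents]

theorem exponent_apply (S : Finset (Fin n)) (j : Fin n) :
    (delta n - ∑ i ∈ S, eps i) j
      = 1 - ((if j ∈ S then 1 else 0) + (if j - 1 ∈ S then 1 else 0)) := by
  rw [Pi.sub_apply, delta]
  simp only [Finset.sum_apply, eps, Pi.add_apply, Finset.sum_add_distrib, Pi.single_apply]
  simp [← sub_eq_iff_eq_add]

end Indices

section MonomialGroup

variable {n ℓ : ℕ}

theorem sum_single_one : ∑ j, (Pi.single j 1 : Fin n → ℤ) = fun _ => 1 := by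
  simpa using (pi_eq_sum_univ' fun _ : Fin n => (1 : ℤ)).symm

/-- The group of monomials `z^p g`, up to scalars; it is the basis of the quantum torus. -/
abbrev MonomialGroup (n ℓ : ℕ) : Type := Multiplicative (Fin n → ℤ) × diagGroup n ℓ

/-- The element of `MonomialGroup` that stands for `z^p g`. -/
abbrev monomial (p : Fin n → ℤ) (g : diagGroup n ℓ) : MonomialGroup n ℓ :=
  (Multiplicative.ofAdd p, g)

/-- The total degree in `z_1, …, z_n`, which defines the leading terms in the quantum torus. -/
def degree (a : MonomialGroup n ℓ) : ℤ := ∑ j, Multiplicative.toAdd a.1 j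

theorem degree_mul (a b : MonomialGroup n ℓ) : degree (a * b) = degree a + degree b := by
  simp [degree, Finset.sum_add_distrib]

theorem degree_monomial (p : Fin n → ℤ) (g : diagGroup n ℓ) : degree (monomial p g) = ∑ j, p j :=
  rfl

theorem monomial_injective :
    Function.Injective fun a : (Fin n → ℕ) × diagGroup n ℓ =>
      monomial (fun j => (a.1 j : ℤ)) a.2 := by
  rintro ⟨p, g⟩ ⟨q, h⟩ hab
  obtain ⟨hpq, hgh⟩ := Prod.ext_iff.1 hab
  refine Prod.ext (funext fun j => ?_) hgh
  exact_mod_cast congrFun (Multiplicative.ofAdd.injective hpq) j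

end MonomialGroup

section Torus

open TwistedGroupAlgebra

variable {n ℓ : ℕ} [NeZero n] (hn : 3 ≤ n) (hℓ : 2 ≤ ℓ) {ζ : ℂ} (hζ : IsPrimitiveRoot ζ ℓ)
  (t : Fin n → ℂ)

/-- The cocycle of the quantum torus: `z^p g · z^q h = α(g, h) χ_q(g) z^(p+q) gh`, where `χ_q` is
the weight of `z^q`. -/
def torusCocycle : TwoCocycle (MonomialGroup n ℓ) where
  toFun a b := alphaFun hn hℓ hζ a.2 b.2 * weight (Multiplicative.toAdd b.1) a.2
  cocycle f g h := by
    simp only [Prod.snd_mul, Prod.fst_mul, toAdd_mul, alphaFun_mul_left, alphaFun_mul_right,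
      weight_add, weight_mul, mul_comm, mul_left_comm, mul_assoc]
  one_left g := by simp [alphaFun_one_left]
  one_right g := by simp [alphaFun_one_right]

/-- The quantum torus `ℂ[z₁^{±1}, …, z_n^{±1}] #_α G`, as a twisted group algebra. -/
abbrev Torus : Type := TwistedGroupAlgebra (torusCocycle hn hℓ hζ)

namespace Torus

/-- The basis element `z^p g`. -/
def mono (p : Fin n → ℤ) (g : diagGroup n ℓ) : Torus hn hℓ hζ :=
  of (torusCocycle hn hℓ hζ) (monomial p g)

/-- The group element `g`. -/
def g (h : diagGroup n ℓ) : Torus hn hℓ hζ := mono hn hℓ hζ 0 h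

/-- The coordinate `z_i`. -/
def z (i : Fin n) : Torus hn hℓ hζ := mono hn hℓ hζ (Pi.single i 1) 1

/-- The scalar `σ_i = t_i / (ζ - 1)`. It agrees with `τ_i` except for the last index. -/
def sigma (ζ : ℂ) (t : Fin n → ℂ) (i : Fin n) : ℂ := t i / (ζ - 1)

/-- The correction `- σ_{i-1} z_{i-1}⁻¹ g_{i-1}` by which the image of `x_i` differs from `z_i`. -/
def b (i : Fin n) : Torus hn hℓ hζ :=
  (-sigma ζ t (i - 1)) • mono hn hℓ hζ (-Pi.single (i - 1) 1) (gen hn hℓ hζ (i - 1))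

/-- The image `z_i + b_i` of `x_i` in the quantum torus. -/
def x (i : Fin n) : Torus hn hℓ hζ := z hn hℓ hζ i + b hn hℓ hζ t i

end Torus

-- Fraktur letters stand for elements of the quantum torus.
local notation "𝔪" => Torus.mono hn hℓ hζ
local notation "𝔤" => Torus.g hn hℓ hζ
local notation "𝔷" => Torus.z hn hℓ hζ
local notation "𝔟" => Torus.b hn hℓ hζ t
local notation "𝔵" => Torus.x hn hℓ hζ t

variable {hn hℓ hζ t}

namespace Torus

theorem mono_mul (p q : Fin n → ℤ) (g h : diagGroup n ℓ) :
    𝔪 p g * 𝔪 q h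
      = ((alphaFun hn hℓ hζ g h * weight q g : ℂˣ) : ℂ) • 𝔪 (p + q) (g * h) :=
  of_mul_of _ _

theorem mono_mul_comm {p q : Fin n → ℤ} {g h : diagGroup n ℓ} (κ : ℂˣ)
    (H : alphaFun hn hℓ hζ g h * weight q g = κ * (alphaFun hn hℓ hζ h g * weight p h)) :
    𝔪 p g * 𝔪 q h = (κ : ℂ) • (𝔪 q h * 𝔪 p g) := by
  rw [mono_mul, mono_mul, H, smul_smul, add_comm p, mul_comm g, Units.val_mul κ]

theorem commute_mono_const (k : ℤ) (f : Torus hn hℓ hζ) : Commute (𝔪 (fun _ => k) 1) f :=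
  commute_of (fun _ => Commute.all _ _) (fun a => by
    simp [torusCocycle, alphaFun_one_left, alphaFun_one_right, weight_const]) f

theorem prod_ofFn_mono_one {m : ℕ} (p : Fin m → Fin n → ℤ) :
    (List.ofFn fun j => 𝔪 (p j) 1).prod = 𝔪 (∑ j, p j) 1 := by
  induction m with
  | zero => rfl
  | succ m ih =>
    rw [List.ofFn_succ, List.prod_cons, ih, mono_mul, Fin.sum_univ_succ]
    simp [alphaFun_one_left]

theorem g_one : 𝔤 1 = 1 := rfl

theorem g_mul_g (g h : diagGroup n ℓ) :
    𝔤 g * 𝔤 h = ((alpha hn hℓ hζ).toFun g h : ℂ) • 𝔤 (g * h) := by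
  simp only [Torus.g, mono_mul, weight_zero, mul_one, add_zero, alpha]

theorem g_mul_z (h : diagGroup n ℓ) (i : Fin n) : 𝔤 h * 𝔷 i = (entry i h : ℂ) • (𝔷 i * 𝔤 h) :=
  mono_mul_comm _ (by simp [alphaFun_one_left, alphaFun_one_right, weight_single])

theorem g_mul_b (h : diagGroup n ℓ) (i : Fin n) : 𝔤 h * 𝔟 i = (entry i h : ℂ) • (𝔟 i * 𝔤 h) := by
  rw [b, mul_smul_comm, smul_mul_assoc, Torus.g, mono_mul_comm (entry i h), smul_comm]
  rw [alphaFun_gen_swap, weight_neg, weight_single, weight_zero, mul_one, sub_add_cancel]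
  rw [mul_assoc, mul_comm (entry (i - 1) h), mul_assoc, mul_inv_cancel, mul_one, mul_comm]

theorem g_mul_x (h : diagGroup n ℓ) (i : Fin n) : 𝔤 h * 𝔵 i = (entry i h : ℂ) • (𝔵 i * 𝔤 h) := by
  rw [x, mul_add, add_mul, g_mul_z, g_mul_b, smul_add]

theorem commute_z (i j : Fin n) : Commute (𝔷 i) (𝔷 j) := by
  have := mono_mul_comm (hn := hn) (hℓ := hℓ) (hζ := hζ) (p := Pi.single i 1) (q := Pi.single j 1)
    (g := 1) (h := 1) 1 (by simp)
  rwa [Units.val_one, one_smul] at this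

theorem b_mul_z (i j : Fin n) : 𝔟 i * 𝔷 j = genEntry ζ (i - 1) j • (𝔷 j * 𝔟 i) := by
  rw [b, smul_mul_assoc, z, mono_mul_comm (entry j (gen hn hℓ hζ (i - 1))), entry_gen, smul_comm,
    mul_smul_comm]
  simp [alphaFun_one_left, alphaFun_one_right, weight_single]

theorem commute_b (i j : Fin n) : Commute (𝔟 i) (𝔟 j) := by
  have hentry : entry j (gen hn hℓ hζ (i - 1)) * entry (i - 1) (gen hn hℓ hζ (j - 1)) = 1 := by
    refine Units.ext ?_
    rw [Units.val_mul, entry_gen, entry_gen, Units.val_one]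
    simpa only [sub_add_cancel] using
      genEntry_mul_genEntry hn (hζ.ne_zero (by omega)) (i - 1) (j - 1)
  have hcomm := mono_mul_comm (hn := hn) (hℓ := hℓ) (hζ := hζ) (p := -Pi.single (i - 1) 1)
    (q := -Pi.single (j - 1) 1) (g := gen hn hℓ hζ (i - 1)) (h := gen hn hℓ hζ (j - 1)) 1 (by
      rw [alphaFun_gen_swap, weight_neg, weight_neg, weight_single, weight_single, one_mul,
        sub_add_cancel, eq_inv_of_mul_eq_one_left hentry]
      simp [mul_assoc])
  rw [Units.val_one, one_smul] at hcomm
  exact ((show Commute _ _ from hcomm).smul_right _).smul_left _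

theorem z_mul_b_succ (i : Fin n) : 𝔷 i * 𝔟 (i + 1) = (-sigma ζ t i) • 𝔤 (gen hn hℓ hζ i) := by
  rw [z, b, mul_smul_comm, mono_mul, add_sub_cancel_right]
  simp [alphaFun_one_left, Torus.g]

theorem x_commutator (i j : Fin n) :
    𝔵 i * 𝔵 j - 𝔵 j * 𝔵 i
      = (1 - genEntry ζ (j - 1) i) • (𝔷 i * 𝔟 j) - (1 - genEntry ζ (i - 1) j) • (𝔷 j * 𝔟 i) := by
  simp only [x, mul_add, add_mul, b_mul_z, (commute_z i j).eq, (commute_b i j).eq, sub_smul,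
    one_smul]
  abel

theorem x_commutator_succ (i : Fin n) :
    𝔵 i * 𝔵 (i + 1) - 𝔵 (i + 1) * 𝔵 i = t i • 𝔤 (gen hn hℓ hζ i) := by
  have hζ1 : ζ - 1 ≠ 0 := sub_ne_zero.2 (hζ.ne_one (by omega))
  have hi : genEntry ζ (i + 1 - 1) i = ζ := by simp [genEntry]
  rw [x_commutator, hi, genEntry_sub_one_add_one hn, sub_self, zero_smul, sub_zero, z_mul_b_succ,
    smul_smul, sigma]
  congr 1
  field_simp
  ring

theorem x_commutator_of_not_adjacent {i j : Fin n} (hij : ¬ Adjacent i j) :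
    𝔵 i * 𝔵 j - 𝔵 j * 𝔵 i = 0 := by
  rcases eq_or_ne i j with rfl | hne
  · exact sub_self _
  · rw [x_commutator, genEntry_sub_one_of_not_adjacent hij hne,
      genEntry_sub_one_of_not_adjacent (fun h => hij h.symm) hne.symm]
    simp

end Torus

/-! ### The representation of the Hecke algebra in the quantum torus -/

variable (hn hℓ hζ t) in
/-- The homomorphism `TV → 𝕋` that sends the basis vector `x_i` to `z_i + b_i`. -/
def tensorToTorus : TV n →ₐ[ℂ] Torus hn hℓ hζ :=
  TensorAlgebra.lift ℂ (Fintype.linearCombination ℂ 𝔵)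

theorem tensorToTorus_ι (v : Fin n → ℂ) :
    tensorToTorus hn hℓ hζ t (TensorAlgebra.ι ℂ v) = ∑ i, v i • 𝔵 i := by
  rw [tensorToTorus, TensorAlgebra.lift_ι_apply, Fintype.linearCombination_apply]

theorem g_mul_tensorToTorus (g : diagGroup n ℓ) (s : TV n) :
    𝔤 g * tensorToTorus hn hℓ hζ t s = tensorToTorus hn hℓ hζ t (act n ℓ g s) * 𝔤 g := by
  induction s using TensorAlgebra.induction with
  | algebraMap r => simp [Algebra.commutes]
  | ι v =>
    rw [act_ι, tensorToTorus_ι, tensorToTorus_ι, Finset.mul_sum, Finset.sum_mul]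
    refine Finset.sum_congr rfl fun i _ => ?_
    rw [mul_smul_comm, Torus.g_mul_x, coe_eq_diagonal, Matrix.mulVec_diagonal, smul_mul_assoc,
      smul_smul, mul_comm, entry_val]
  | mul a b ha hb => rw [map_mul, map_mul, map_mul, ← mul_assoc, ha, mul_assoc, hb, mul_assoc]
  | add a b ha hb => rw [map_add, map_add, map_add, mul_add, add_mul, ha, hb]

variable (hn hℓ hζ t) in
/-- The homomorphism from the crossed product `TV #_α G` to the quantum torus. -/
def crossedToTorus : TVG hn hℓ hζ →ₐ[ℂ] Torus hn hℓ hζ :=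
  CrossedProduct.lift (tensorToTorus hn hℓ hζ t) 𝔤 Torus.g_one Torus.g_mul_g g_mul_tensorToTorus

theorem crossedToTorus_xT (i : Fin n) : crossedToTorus hn hℓ hζ t (xT hn hℓ hζ i) = 𝔵 i := by
  rw [crossedToTorus, xT, CrossedProduct.lift_tmul, Torus.g_one, mul_one, tensorToTorus_ι]
  simp [Pi.single_apply]

theorem crossedToTorus_gT (g : diagGroup n ℓ) :
    crossedToTorus hn hℓ hζ t (gT hn hℓ hζ g) = 𝔤 g := by
  rw [crossedToTorus, gT, CrossedProduct.lift_tmul, map_one, one_mul]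

variable (hn hℓ hζ t) in
/-- The homomorphism `x_i ↦ z_i + b_i`, `g ↦ g` from the Hecke algebra to the quantum torus. -/
def toTorus : Hecke hn hℓ hζ t →ₐ[ℂ] Torus hn hℓ hζ :=
  RingQuot.liftAlgHom ℂ ⟨crossedToTorus hn hℓ hζ t, by
    intro a b h
    cases h with
    | adjacent i =>
      rw [map_sub, map_mul, map_mul, map_smul, crossedToTorus_xT, crossedToTorus_xT,
        crossedToTorus_gT, Torus.x_commutator_succ]
    | nonadjacent i j hij =>
      rw [map_sub, map_mul, map_mul, map_zero, crossedToTorus_xT, crossedToTorus_xT,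
        Torus.x_commutator_of_not_adjacent hij]⟩

theorem toTorus_mk (a : TVG hn hℓ hζ) :
    toTorus hn hℓ hζ t (Hecke.mk hn hℓ hζ t a) = crossedToTorus hn hℓ hζ t a :=
  RingQuot.liftAlgHom_mkAlgHom_apply _ _ _ _

theorem toTorus_x (i : Fin n) : toTorus hn hℓ hζ t (Hecke.x hn hℓ hζ t i) = 𝔵 i := by
  rw [Hecke.x, toTorus_mk, crossedToTorus_xT]

variable (hn hℓ hζ t) in
/-- The image of a group element in the Hecke algebra. -/
def Hecke.ofGroup (h : diagGroup n ℓ) : Hecke hn hℓ hζ t :=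
  Hecke.mk hn hℓ hζ t (gT hn hℓ hζ h)

theorem toTorus_ofGroup (h : diagGroup n ℓ) :
    toTorus hn hℓ hζ t (Hecke.ofGroup hn hℓ hζ t h) = 𝔤 h := by
  rw [Hecke.ofGroup, toTorus_mk, crossedToTorus_gT]

-- Upright bold letters stand for elements of the Hecke algebra.
local notation "𝐱" => Hecke.x hn hℓ hζ t
local notation "𝐠" => Hecke.ofGroup hn hℓ hζ t

/-! ### Generators of the Hecke algebra -/

namespace Hecke

theorem mk_ι (v : Fin n → ℂ) :
    Hecke.mk hn hℓ hζ t (CrossedProduct.incl _ _ (TensorAlgebra.ι ℂ v)) = ∑ i, v i • 𝐱 i := by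
  have hv : v = ∑ i, v i • Pi.single i (1 : ℂ) := pi_eq_sum_univ' v
  conv_lhs => rw [hv]
  simp only [map_sum, map_smul]
  rfl

theorem adjoin_generators :
    Algebra.adjoin ℂ (Set.range 𝐱 ∪ Set.range 𝐠) = ⊤ := by
  set S := Algebra.adjoin ℂ (Set.range 𝐱 ∪ Set.range 𝐠)
  have hx : ∀ i, 𝐱 i ∈ S := fun i => Algebra.subset_adjoin (Or.inl ⟨i, rfl⟩)
  have hg : ∀ g, 𝐠 g ∈ S := fun g => Algebra.subset_adjoin (Or.inr ⟨g, rfl⟩)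
  have hTV : ∀ r : TV n, Hecke.mk hn hℓ hζ t (CrossedProduct.incl _ _ r) ∈ S := by
    have : Algebra.adjoin ℂ (Set.range (TensorAlgebra.ι ℂ))
        ≤ S.comap ((Hecke.mk hn hℓ hζ t).comp (CrossedProduct.incl _ _)) :=
      Algebra.adjoin_le (by
        rintro _ ⟨v, rfl⟩
        have hsum : ∑ i, v i • 𝐱 i ∈ S := sum_mem fun i _ => S.smul_mem (hx i) _
        rwa [← mk_ι] at hsum)
    rw [TensorAlgebra.adjoin_range_ι] at this
    exact fun r => this trivial
  refine Algebra.eq_top_iff.2 fun y => ?_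
  obtain ⟨a, rfl⟩ : ∃ a, Hecke.mk hn hℓ hζ t a = y := RingQuot.mkAlgHom_surjective ℂ _ y
  induction a using CrossedProduct.induction with
  | zero => rw [map_zero]; exact zero_mem S
  | add a b ha hb => rw [map_add]; exact add_mem ha hb
  | tmul r g =>
    rw [CrossedProduct.tmul_eq_incl_mul, map_mul]
    exact mul_mem (hTV r) (hg g)

theorem mem_center_of_commute {y : Hecke hn hℓ hζ t} (hx : ∀ i, Commute (𝐱 i) y)
    (hg : ∀ g, Commute (𝐠 g) y) : y ∈ Subalgebra.center ℂ (Hecke hn hℓ hζ t) :=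
  mem_center_of_adjoin_eq_top adjoin_generators (by
    rintro _ (⟨i, rfl⟩ | ⟨g, rfl⟩)
    exacts [hx i, hg g])

theorem ofGroup_one : 𝐠 1 = 1 := map_one _

theorem ofGroup_mul_ofGroup (g h : diagGroup n ℓ) :
    𝐠 g * 𝐠 h = (alphaFun hn hℓ hζ g h : ℂ) • 𝐠 (g * h) := by
  rw [ofGroup, ofGroup, ← map_mul, gT, gT, CrossedProduct.tmul_mul_tmul, map_one, mul_one,
    ← CrossedProduct.smul_tmul, map_smul]
  rfl

theorem ofGroup_mul_x (g : diagGroup n ℓ) (i : Fin n) :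
    𝐠 g * 𝐱 i = (entry i g : ℂ) • (𝐱 i * 𝐠 g) := by
  have hact : Matrix.mulVec g.1.1 (Pi.single i 1) = (entry i g : ℂ) • Pi.single i (1 : ℂ) := by
    rw [coe_eq_diagonal, entry_val, Matrix.diagonal_mulVec_single, ← Pi.single_smul, smul_eq_mul]
  have hcross : gT hn hℓ hζ g * xT hn hℓ hζ i
      = (entry i g : ℂ) • (xT hn hℓ hζ i * gT hn hℓ hζ g) := by
    rw [gT, xT, CrossedProduct.tmul_mul_tmul, CrossedProduct.tmul_mul_tmul,
      (alpha hn hℓ hζ).one_left, (alpha hn hℓ hζ).one_right, act_ι, hact,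
      CrossedProduct.smul_tmul]
    simp
  rw [ofGroup, Hecke.x, ← map_mul, hcross, map_smul, map_mul]

theorem mk_eq_mk_of_rel {a b : TVG hn hℓ hζ} (h : Rel hn hℓ hζ t a b) :
    Hecke.mk hn hℓ hζ t a = Hecke.mk hn hℓ hζ t b :=
  RingQuot.mkAlgHom_rel ℂ h

theorem x_commutator_succ (i : Fin n) :
    𝐱 i * 𝐱 (i + 1) - 𝐱 (i + 1) * 𝐱 i = t i • 𝐠 (gen hn hℓ hζ i) := by
  have h := mk_eq_mk_of_rel (t := t) (Rel.adjacent (hn := hn) (hℓ := hℓ) (hζ := hζ) i)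
  rwa [map_sub, map_mul, map_mul, map_smul] at h

theorem commute_x_of_not_adjacent {i j : Fin n} (hij : ¬ Adjacent i j) :
    Commute (𝐱 i) (𝐱 j) := by
  have h := mk_eq_mk_of_rel (t := t) (Rel.nonadjacent (hn := hn) (hℓ := hℓ) (hζ := hζ) i j hij)
  rw [map_sub, map_mul, map_mul, map_zero] at h
  exact sub_eq_zero.1 h

theorem exists_x_commutator_eq_smul_ofGroup (i j : Fin n) :
    ∃ (c : ℂ) (g : diagGroup n ℓ), 𝐱 i * 𝐱 j - 𝐱 j * 𝐱 i = c • 𝐠 g := by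
  by_cases hij : Adjacent i j
  · rcases hij with rfl | rfl
    · exact ⟨_, _, x_commutator_succ i⟩
    · exact ⟨-t j, gen hn hℓ hζ j, by rw [neg_smul, ← x_commutator_succ j, neg_sub]⟩
  · exact ⟨0, 1, by rw [(commute_x_of_not_adjacent hij).eq, sub_self, zero_smul]⟩

/-! ### Straightening -/

variable (hn hℓ hζ t) in
/-- The product of the generators `x_i` along a list of indices. -/
def xword (l : List (Fin n)) : Hecke hn hℓ hζ t := (l.map 𝐱).prod

theorem xword_cons (i : Fin n) (l : List (Fin n)) :
    xword hn hℓ hζ t (i :: l) = 𝐱 i * xword hn hℓ hζ t l := by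
  rw [xword, List.map_cons, List.prod_cons, ← xword]

theorem exists_ofGroup_mul_xword_eq_smul (g : diagGroup n ℓ) (l : List (Fin n)) :
    ∃ c : ℂ, 𝐠 g * xword hn hℓ hζ t l = c • (xword hn hℓ hζ t l * 𝐠 g) := by
  induction l with
  | nil => exact ⟨1, by simp [xword]⟩
  | cons i l ih =>
    obtain ⟨c, hc⟩ := ih
    refine ⟨entry i g * c, ?_⟩
    rw [xword_cons, ← mul_assoc, ofGroup_mul_x, smul_mul_assoc, mul_assoc, hc, mul_smul_comm,
      smul_smul, mul_assoc]

variable (hn hℓ hζ t) in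
/-- The span of the elements `x_{i_1} ⋯ x_{i_k} g` with `k < d`. -/
def filt (d : ℕ) : Submodule ℂ (Hecke hn hℓ hζ t) :=
  Submodule.span ℂ
    {y | ∃ l : List (Fin n), l.length < d ∧ ∃ h, xword hn hℓ hζ t l * 𝐠 h = y}

theorem filt_le {d : ℕ} {N : Submodule ℂ (Hecke hn hℓ hζ t)}
    (hN : ∀ l : List (Fin n), l.length < d → ∀ h, xword hn hℓ hζ t l * 𝐠 h ∈ N) :
    filt hn hℓ hζ t d ≤ N :=
  Submodule.span_le.2 (by rintro _ ⟨l, hl, h, rfl⟩; exact hN l hl h)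

theorem xword_mul_ofGroup_mem_filt {d : ℕ} {l : List (Fin n)} (hl : l.length < d)
    (h : diagGroup n ℓ) : xword hn hℓ hζ t l * 𝐠 h ∈ filt hn hℓ hζ t d :=
  Submodule.subset_span ⟨l, hl, h, rfl⟩

theorem x_mul_mem_filt (i : Fin n) {d : ℕ} {y : Hecke hn hℓ hζ t} (hy : y ∈ filt hn hℓ hζ t d) :
    𝐱 i * y ∈ filt hn hℓ hζ t (d + 1) := by
  suffices filt hn hℓ hζ t d ≤ (filt hn hℓ hζ t (d + 1)).comap (LinearMap.mulLeft ℂ (𝐱 i)) from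
    this hy
  refine filt_le fun l hl h => ?_
  rw [Submodule.mem_comap, LinearMap.mulLeft_apply, ← mul_assoc, ← xword_cons]
  exact xword_mul_ofGroup_mem_filt (by rw [List.length_cons]; omega) h

theorem mul_ofGroup_mem_filt (g : diagGroup n ℓ) {d : ℕ} {y : Hecke hn hℓ hζ t}
    (hy : y ∈ filt hn hℓ hζ t d) : y * 𝐠 g ∈ filt hn hℓ hζ t d := by
  suffices filt hn hℓ hζ t d ≤ (filt hn hℓ hζ t d).comap (LinearMap.mulRight ℂ (𝐠 g)) from
    this hy
  refine filt_le fun l hl h => ?_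
  rw [Submodule.mem_comap, LinearMap.mulRight_apply, mul_assoc, ofGroup_mul_ofGroup,
    mul_smul_comm]
  exact Submodule.smul_mem _ _ (xword_mul_ofGroup_mem_filt hl _)

theorem xword_sub_mem_filt {l l' : List (Fin n)} (h : l.Perm l') :
    xword hn hℓ hζ t l - xword hn hℓ hζ t l' ∈ filt hn hℓ hζ t l.length := by
  induction h with
  | nil => simp
  | cons i h ih =>
    rw [xword_cons, xword_cons, ← mul_sub]
    exact x_mul_mem_filt i ih
  | swap i j l =>
    obtain ⟨c, g, hc⟩ := exists_x_commutator_eq_smul_ofGroup (t := t) j i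
    obtain ⟨e, he⟩ := exists_ofGroup_mul_xword_eq_smul (t := t) g l
    simp only [xword_cons, ← mul_assoc]
    rw [← sub_mul, hc, smul_mul_assoc, he]
    refine Submodule.smul_mem _ _ (Submodule.smul_mem _ _ ?_)
    exact xword_mul_ofGroup_mem_filt (by simp) g
  | trans h₁ _ ih₁ ih₂ =>
    rw [← h₁.length_eq] at ih₂
    simpa only [sub_add_sub_cancel] using add_mem ih₁ ih₂

/-! ### The PBW basis -/

/-- The list of indices of the ordered monomial `x_1^{p_1} ⋯ x_n^{p_n}`. -/
def sortedWord {m : ℕ} (p : Fin m → ℕ) : List (Fin m) :=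
  (List.ofFn fun j => List.replicate (p j) j).flatten

theorem count_sortedWord {m : ℕ} (p : Fin m → ℕ) (i : Fin m) : (sortedWord p).count i = p i := by
  rw [sortedWord, List.count_flatten, List.map_ofFn, List.sum_ofFn]
  simp [List.count_replicate]

variable (hn hℓ hζ t) in
/-- The PBW monomial `x^p g`. -/
def pbw (a : (Fin n → ℕ) × diagGroup n ℓ) : Hecke hn hℓ hζ t :=
  xword hn hℓ hζ t (sortedWord a.1) * 𝐠 a.2

theorem xword_mul_ofGroup_mem_span_pbw (l : List (Fin n)) (h : diagGroup n ℓ) :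
    xword hn hℓ hζ t l * 𝐠 h ∈ Submodule.span ℂ (Set.range (pbw hn hℓ hζ t)) := by
  induction hd : l.length using Nat.strong_induction_on generalizing l h with
  | _ d ih =>
    let p : Fin n → ℕ := fun i => l.count i
    have hperm : l.Perm (sortedWord p) := List.perm_iff_count.2 fun i => (count_sortedWord p i).symm
    have hlow := mul_ofGroup_mem_filt (hn := hn) (hℓ := hℓ) (hζ := hζ) (t := t) h
      (xword_sub_mem_filt hperm)
    rw [sub_mul, hd] at hlow
    rw [← sub_add_cancel (xword hn hℓ hζ t l * 𝐠 h) (pbw hn hℓ hζ t (p, h))]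
    exact add_mem (filt_le (fun l' hl' h' => ih _ hl' l' h' rfl) hlow)
      (Submodule.subset_span ⟨_, rfl⟩)

theorem span_pbw : Submodule.span ℂ (Set.range (pbw hn hℓ hζ t)) = ⊤ := by
  refine submodule_eq_top_of_adjoin_eq_top adjoin_generators ?_ ?_
  · simpa [xword, ofGroup_one] using xword_mul_ofGroup_mem_span_pbw (hn := hn) (hℓ := hℓ)
      (hζ := hζ) (t := t) [] 1
  rintro a ha y hy
  suffices Submodule.span ℂ (Set.range (pbw hn hℓ hζ t)) ≤
      (Submodule.span ℂ (Set.range (pbw hn hℓ hζ t))).comap (LinearMap.mulLeft ℂ a) from this hy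
  rw [Submodule.span_le]
  rintro _ ⟨⟨p, h⟩, rfl⟩
  rw [SetLike.mem_coe, Submodule.mem_comap, LinearMap.mulLeft_apply, pbw, ← mul_assoc]
  obtain ⟨i, rfl⟩ | ⟨g, rfl⟩ := ha
  · rw [← xword_cons]
    exact xword_mul_ofGroup_mem_span_pbw _ _
  · obtain ⟨c, hc⟩ := exists_ofGroup_mul_xword_eq_smul (t := t) g (sortedWord p)
    rw [hc, smul_mul_assoc, mul_assoc, ofGroup_mul_ofGroup, mul_smul_comm]
    exact Submodule.smul_mem _ _ (Submodule.smul_mem _ _ (xword_mul_ofGroup_mem_span_pbw _ _))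

theorem exists_linearCombination_pbw (y : Hecke hn hℓ hζ t) :
    ∃ c, Finsupp.linearCombination ℂ (pbw hn hℓ hζ t) c = y := by
  have hy : y ∈ Submodule.span ℂ (Set.range (pbw hn hℓ hζ t)) := by rw [span_pbw]; trivial
  rwa [Finsupp.mem_span_range_iff_exists_finsupp] at hy

end Hecke

/-! ### Leading terms in the quantum torus -/

namespace Torus

theorem torusCocycle_one_left (p : Fin n → ℤ) (a : MonomialGroup n ℓ) :
    (torusCocycle hn hℓ hζ).toFun (monomial p 1) a = 1 := by
  simp [torusCocycle, alphaFun_one_left]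

theorem hasLead_mul {p q : Fin n → ℤ} {h : diagGroup n ℓ} {u v : Torus hn hℓ hζ}
    (hu : HasLead degree (monomial p 1) u) (hv : HasLead degree (monomial q h) v) :
    HasLead degree (monomial (p + q) h) (u * v) := by
  simpa [monomial] using hu.mul degree_mul hv (torusCocycle_one_left p _)

theorem hasLead_one : HasLead degree (monomial 0 1) (1 : Torus hn hℓ hζ) := hasLead_of 1

theorem hasLead_pow {p : Fin n → ℤ} {u : Torus hn hℓ hζ} (hu : HasLead degree (monomial p 1) u)
    (k : ℕ) : HasLead degree (monomial (k • p) 1) (u ^ k) := by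
  induction k with
  | zero => simpa using hasLead_one
  | succ k ih => simpa only [succ_nsmul, pow_succ] using hasLead_mul ih hu

theorem hasLead_prod_ofFn {m : ℕ} {p : Fin m → Fin n → ℤ} {u : Fin m → Torus hn hℓ hζ}
    (hu : ∀ j, HasLead degree (monomial (p j) 1) (u j)) :
    HasLead degree (monomial (∑ j, p j) 1) (List.ofFn u).prod := by
  induction m with
  | zero => simpa using hasLead_one
  | succ m ih =>
    rw [Fin.sum_univ_succ, List.ofFn_succ, List.prod_cons]
    exact hasLead_mul (hu 0) (ih fun j => hu j.succ)

theorem hasLead_g (g : diagGroup n ℓ) : HasLead degree (monomial 0 g) (𝔤 g) := hasLead_of _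

theorem b_mem_degLT (i : Fin n) : 𝔟 i ∈ degLT (torusCocycle hn hℓ hζ) degree 0 :=
  Submodule.smul_mem _ _ (of_mem_degLT (by simp [degree_monomial]))

theorem hasLead_x (i : Fin n) : HasLead degree (monomial (Pi.single i 1) 1) (𝔵 i) := by
  rw [HasLead, x, z, mono, add_sub_cancel_left]
  exact degLT_mono (by simp [degree_monomial]) (b_mem_degLT i)

end Torus

theorem toTorus_xword (l : List (Fin n)) :
    toTorus hn hℓ hζ t (Hecke.xword hn hℓ hζ t l) = (l.map 𝔵).prod := by
  rw [Hecke.xword, map_list_prod, List.map_map]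
  exact congrArg List.prod (List.map_congr_left fun i _ => toTorus_x i)

theorem hasLead_toTorus_pbw (a : (Fin n → ℕ) × diagGroup n ℓ) :
    HasLead degree (monomial (fun j => (a.1 j : ℤ)) a.2)
      (toTorus hn hℓ hζ t (Hecke.pbw hn hℓ hζ t a)) := by
  have hx := Torus.hasLead_prod_ofFn fun j =>
    Torus.hasLead_pow (Torus.hasLead_x (hn := hn) (hℓ := hℓ) (hζ := hζ) (t := t) j) (a.1 j)
  have hsum : ∑ j, a.1 j • (Pi.single j 1 : Fin n → ℤ) = fun j => (a.1 j : ℤ) := by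
    simpa using (pi_eq_sum_univ' fun j => (a.1 j : ℤ)).symm
  rw [hsum] at hx
  rw [Hecke.pbw, map_mul, toTorus_xword, toTorus_ofGroup]
  simpa [Hecke.sortedWord, List.map_flatten, List.prod_flatten, List.map_ofFn, Function.comp_def]
    using Torus.hasLead_mul hx (Torus.hasLead_g a.2)

theorem eq_zero_of_toTorus_mem_degLT {y : Hecke hn hℓ hζ t}
    (hy : toTorus hn hℓ hζ t y ∈ degLT (torusCocycle hn hℓ hζ) degree 0) : y = 0 := by
  obtain ⟨c, rfl⟩ := Hecke.exists_linearCombination_pbw y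
  rw [← AlgHom.toLinearMap_apply, LinearMap.map_finsupp_linearCombination] at hy
  suffices c = 0 by rw [this, map_zero]
  refine Finsupp.ext fun a => ?_
  refine eq_zero_of_linearCombination_mem_degLT hasLead_toTorus_pbw monomial_injective hy ?_
  rw [degree_monomial]
  positivity

theorem toTorus_injective : Function.Injective (toTorus hn hℓ hζ t) :=
  (injective_iff_map_eq_zero _).2 fun _ hy =>
    eq_zero_of_toTorus_mem_degLT (by rw [hy]; exact zero_mem _)

theorem exists_nat_eq_of_coeff_toTorus_ne_zero {y : Hecke hn hℓ hζ t} {p : Fin n → ℤ}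
    {g : diagGroup n ℓ}
    (hy : toTorus hn hℓ hζ t y ∈
      degLT (torusCocycle hn hℓ hζ) degree (degree (monomial p g) + 1))
    (hp : coeff (monomial p g) (toTorus hn hℓ hζ t y) ≠ 0) :
    ∃ q : Fin n → ℕ, p = fun j => (q j : ℤ) := by
  obtain ⟨c, rfl⟩ := Hecke.exists_linearCombination_pbw y
  rw [← AlgHom.toLinearMap_apply, LinearMap.map_finsupp_linearCombination] at hy hp
  obtain ⟨⟨q, h⟩, hqp⟩ :=
    exists_eq_of_coeff_linearCombination_ne_zero hasLead_toTorus_pbw monomial_injective hy hp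
  exact ⟨q, (Multiplicative.ofAdd.injective (congrArg Prod.fst hqp)).symm⟩

/-! ### The image of `w` -/

namespace Torus

theorem prod_z : (List.ofFn 𝔷).prod = 𝔪 (fun _ => 1) 1 := by
  rw [← sum_single_one]
  exact prod_ofFn_mono_one _

theorem exists_prod_b_eq : ∃ e : ℂ, (List.ofFn 𝔟).prod = e • 𝔪 (fun _ => -1) 1 := by
  obtain ⟨e, he⟩ := exists_prod_ofFn_smul_of (α := torusCocycle hn hℓ hζ)
    (fun j => -sigma ζ t (j - 1))
    fun j => monomial (-Pi.single (j - 1) 1) (gen hn hℓ hζ (j - 1))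
  have hexp : ∑ j : Fin n, -(Pi.single (j - 1) 1 : Fin n → ℤ) = fun _ => -1 := by
    have hshift := (Equiv.subRight (1 : Fin n)).sum_comp fun i => (Pi.single i 1 : Fin n → ℤ)
    rw [Finset.sum_neg_distrib]
    exact congrArg Neg.neg (hshift.trans sum_single_one)
  have hgen : ∏ j, gen hn hℓ hζ (j - 1) = 1 :=
    ((Equiv.subRight (1 : Fin n)).prod_comp (gen hn hℓ hζ)).trans prod_gen
  rw [List.prod_ofFn (f := fun j => monomial _ _)] at he
  refine ⟨e, he.trans (congrArg (fun a => e • of _ a) (Prod.ext ?_ ?_))⟩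
  · rw [Prod.fst_prod, ← ofAdd_sum, hexp]
  · rw [Prod.snd_prod, hgen]

theorem g_gen_commute_z {i j : Fin n} (h : j ≠ i) (h' : j ≠ i + 1) :
    Commute (𝔤 (gen hn hℓ hζ i)) (𝔷 j) := by
  have hcomm := g_mul_z (hn := hn) (hℓ := hℓ) (hζ := hζ) (gen hn hℓ hζ i) j
  rwa [entry_gen, genEntry, if_neg h, if_neg h', one_smul] at hcomm

theorem g_gen_commute_b {i j : Fin n} (h : j ≠ i) (h' : j ≠ i + 1) :
    Commute (𝔤 (gen hn hℓ hζ i)) (𝔟 j) := by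
  have hcomm := g_mul_b (hn := hn) (hℓ := hℓ) (hζ := hζ) (t := t) (gen hn hℓ hζ i) j
  rwa [entry_gen, genEntry, if_neg h, if_neg h', one_smul] at hcomm

theorem b_succ_commute_z {i j : Fin n} (h : j ≠ i) (h' : j ≠ i + 1) :
    Commute (𝔟 (i + 1)) (𝔷 j) := by
  have hcomm := b_mul_z (hn := hn) (hℓ := hℓ) (hζ := hζ) (t := t) (i + 1) j
  rwa [add_sub_cancel_right, genEntry, if_neg h, if_neg h', one_smul] at hcomm

theorem b_succ_mul_z (i : Fin n) :
    𝔟 (i + 1) * 𝔷 i = (-(ζ * sigma ζ t i)) • 𝔤 (gen hn hℓ hζ i) := by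
  rw [b_mul_z, add_sub_cancel_right, z_mul_b_succ, smul_smul, genEntry, if_pos rfl, mul_neg]

variable (hn hℓ hζ) in
/-- The `j`-th factor of the summand of `w` at `S` when `z_j` is chosen from each `x_j = z_j + b_j`.
The group elements `τ_j g_j` count as a choice of `z_j`. -/
def zFactor (t : Fin n → ℂ) (S : Finset (Fin n)) (j : Fin n) : Torus hn hℓ hζ :=
  if j ∈ S then tau ζ t j • 𝔤 (gen hn hℓ hζ j) else if j - 1 ∈ S then 0 else 𝔷 j

variable (hn hℓ hζ t) in
/-- The `j`-th factor of the summand of `w` at `S` when `b_j` is chosen from each `x_j = z_j + b_j`.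
The empty position that follows `g_{j-1}` counts as a choice of `b_j`. -/
def bFactor (S : Finset (Fin n)) (j : Fin n) : Torus hn hℓ hζ :=
  if j ∈ S then 0 else if j - 1 ∈ S then 1 else 𝔟 j

variable (hn hℓ hζ t) in
/-- The `j`-th factor of the summand of `w` at `S` when `z_j` is chosen at the positions in `T` and
`b_j` elsewhere. -/
def wFactor (S T : Finset (Fin n)) : Fin n → Torus hn hℓ hζ :=
  T.piecewise (zFactor hn hℓ hζ t S) (bFactor hn hℓ hζ t S)

variable (hn hℓ hζ t) in
/-- The contribution to the image of `w` of the set `S`, when `z_j` is chosen at the positions in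
`T` and `b_j` elsewhere. -/
def wTerm (S T : Finset (Fin n)) : Torus hn hℓ hζ := (List.ofFn (wFactor hn hℓ hζ t S T)).prod

end Torus

theorem toTorus_xpow_exponent {S : Finset (Fin n)} (hS : S ∈ nonadjacentSets n) :
    toTorus hn hℓ hζ t (Hecke.xpow hn hℓ hζ t (delta n - ∑ i ∈ S, eps i))
      = (List.ofFn fun j => if j ∈ S ∨ j - 1 ∈ S then 1 else 𝔵 j).prod := by
  rw [Hecke.xpow, map_list_prod, List.map_ofFn]
  congr 2
  ext1 j
  rw [Function.comp_apply, map_pow, toTorus_x, exponent_apply]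
  by_cases hj : j ∈ S
  · have hj' : j - 1 ∉ S := fun h => mem_nonadjacentSets.1 hS _ h (by simpa using hj)
    simp [hj, hj']
  · by_cases hj' : j - 1 ∈ S <;> simp [hj, hj']

theorem toTorus_prod_sort_g (S : Finset (Fin n)) :
    toTorus hn hℓ hζ t ((S.sort (· ≤ ·)).map (Hecke.g hn hℓ hζ t)).prod
      = (List.ofFn fun j => if j ∈ S then 𝔤 (gen hn hℓ hζ j) else 1).prod := by
  rw [map_list_prod, List.map_map, ← prod_map_sort]
  exact congrArg List.prod (List.map_congr_left fun j _ => toTorus_ofGroup _)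

theorem toTorus_xpow_mul_prod_g {S : Finset (Fin n)} (hS : S ∈ nonadjacentSets n) :
    toTorus hn hℓ hζ t (Hecke.xpow hn hℓ hζ t (delta n - ∑ i ∈ S, eps i) *
        ((S.sort (· ≤ ·)).map (Hecke.g hn hℓ hζ t)).prod)
      = (List.ofFn fun j => (if j ∈ S ∨ j - 1 ∈ S then 1 else 𝔵 j) *
          if j ∈ S then 𝔤 (gen hn hℓ hζ j) else 1).prod := by
  rw [map_mul, toTorus_xpow_exponent hS, toTorus_prod_sort_g]
  refine prod_ofFn_mul_prod_ofFn _ _ fun i j _ => ?_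
  split_ifs with hi hj
  · exact Commute.one_right _
  · rw [not_or] at hj
    have hji : j ≠ i := fun h => hj.1 (h ▸ hi)
    have hji' : j ≠ i + 1 := fun h => hj.2 (by rwa [h, add_sub_cancel_right])
    exact (Torus.g_gen_commute_z hji hji').add_right (Torus.g_gen_commute_b hji hji')
  all_goals exact Commute.one_left _

theorem toTorus_w_summand {S : Finset (Fin n)} (hS : S ∈ nonadjacentSets n) :
    toTorus hn hℓ hζ t ((∏ i ∈ S, tau ζ t i) •
      (Hecke.xpow hn hℓ hζ t (delta n - ∑ i ∈ S, eps i) *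
        ((S.sort (· ≤ ·)).map (Hecke.g hn hℓ hζ t)).prod))
      = ∑ T, Torus.wTerm hn hℓ hζ t S T := by
  have htau : ∏ i ∈ S, tau ζ t i = ∏ i, if i ∈ S then tau ζ t i else 1 := by
    rw [Finset.prod_ite_mem, Finset.univ_inter]
  have hsmul := (MultilinearMap.mkPiAlgebraFin ℂ n (Torus hn hℓ hζ)).map_smul_univ
    (fun i => if i ∈ S then tau ζ t i else 1)
    fun j => (if j ∈ S ∨ j - 1 ∈ S then 1 else 𝔵 j) * if j ∈ S then 𝔤 (gen hn hℓ hζ j) else 1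
  have hadd := (MultilinearMap.mkPiAlgebraFin ℂ n (Torus hn hℓ hζ)).map_add_univ
    (Torus.zFactor hn hℓ hζ t S) (Torus.bFactor hn hℓ hζ t S)
  simp only [MultilinearMap.mkPiAlgebraFin_apply] at hsmul hadd
  rw [map_smul, toTorus_xpow_mul_prod_g hS, htau, ← hsmul]
  refine Eq.trans (congrArg (fun m => (List.ofFn m).prod) (funext fun j => ?_)) hadd
  rw [Pi.add_apply, Torus.zFactor, Torus.bFactor]
  by_cases hj : j ∈ S
  · simp [hj]
  · by_cases hj' : j - 1 ∈ S <;> simp [hj, hj', Torus.x]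

namespace Torus

section Factors

variable {S T : Finset (Fin n)} {i j : Fin n}

theorem wFactor_insert_self (hST : insert i S ⊆ descents T) :
    wFactor hn hℓ hζ t (insert i S) T i = tau ζ t i • 𝔤 (gen hn hℓ hζ i) := by
  have hT : i ∈ T := (mem_descents.1 (hST (Finset.mem_insert_self i S))).1
  rw [wFactor, Finset.piecewise_eq_of_mem _ _ _ hT, zFactor, if_pos (Finset.mem_insert_self i S)]

theorem wFactor_insert_succ (hST : insert i S ⊆ descents T) :
    wFactor hn hℓ hζ t (insert i S) T (i + 1) = 1 := by
  have hT : i + 1 ∉ T := (mem_descents.1 (hST (Finset.mem_insert_self i S))).2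
  have hS : i + 1 ∉ insert i S := fun h => hT (mem_descents.1 (hST h)).1
  rw [wFactor, Finset.piecewise_eq_of_notMem _ _ _ hT, bFactor, if_neg hS, if_pos (by simp)]

theorem wFactor_of_notMem (hi : i ∉ S) (hST : insert i S ⊆ descents T) :
    wFactor hn hℓ hζ t S T i = 𝔷 i := by
  have hT : i ∈ T := (mem_descents.1 (hST (Finset.mem_insert_self i S))).1
  have hpred : i - 1 ∉ S := fun h =>
    (mem_descents.1 (hST (Finset.mem_insert_of_mem h))).2 (by rwa [sub_add_cancel])
  rw [wFactor, Finset.piecewise_eq_of_mem _ _ _ hT, zFactor, if_neg hi, if_neg hpred]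

theorem wFactor_succ_of_notMem (hi : i ∉ S) (hST : insert i S ⊆ descents T) :
    wFactor hn hℓ hζ t S T (i + 1) = 𝔟 (i + 1) := by
  have hT : i + 1 ∉ T := (mem_descents.1 (hST (Finset.mem_insert_self i S))).2
  have hS : i + 1 ∉ S := fun h => hT (mem_descents.1 (hST (Finset.mem_insert_of_mem h))).1
  rw [wFactor, Finset.piecewise_eq_of_notMem _ _ _ hT, bFactor, if_neg hS,
    if_neg (by rwa [add_sub_cancel_right])]

theorem wFactor_insert_of_ne (h : j ≠ i) (h' : j ≠ i + 1) :
    wFactor hn hℓ hζ t (insert i S) T j = wFactor hn hℓ hζ t S T j := by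
  have hpred : j - 1 ≠ i := fun h => h' (by rw [← h, sub_add_cancel])
  simp only [wFactor, Finset.piecewise, zFactor, bFactor, Finset.mem_insert, h, hpred, false_or]

theorem b_succ_commute_wFactor (h : j ≠ i) (h' : j ≠ i + 1) :
    Commute (𝔟 (i + 1)) (wFactor hn hℓ hζ t S T j) := by
  by_cases hT : j ∈ T
  · rw [wFactor, Finset.piecewise_eq_of_mem _ _ _ hT, zFactor]
    split_ifs with hS
    · refine (g_gen_commute_b ?_ ?_).symm.smul_right _
      exacts [h'.symm, fun hij => h (add_right_cancel hij).symm]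
    · exact Commute.zero_right _
    · exact b_succ_commute_z h h'
  · rw [wFactor, Finset.piecewise_eq_of_notMem _ _ _ hT, bFactor]
    split_ifs
    · exact Commute.zero_right _
    · exact Commute.one_right _
    · exact commute_b _ _

end Factors

theorem wTerm_eq_zero {S T : Finset (Fin n)} (hS : S ∈ nonadjacentSets n)
    (hST : ¬ S ⊆ descents T) : wTerm hn hℓ hζ t S T = 0 := by
  rw [mem_nonadjacentSets] at hS
  obtain ⟨j, hj, hjT⟩ := Finset.not_subset.1 hST
  suffices ∃ i, wFactor hn hℓ hζ t S T i = 0 from List.prod_eq_zero (List.mem_ofFn.2 this)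
  by_cases h : j ∈ T
  · have h' : j + 1 ∈ T := by_contra fun h' => hjT (mem_descents.2 ⟨h, h'⟩)
    refine ⟨j + 1, ?_⟩
    rw [wFactor, Finset.piecewise_eq_of_mem _ _ _ h', zFactor, if_neg (hS j hj),
      if_pos (by rwa [add_sub_cancel_right])]
  · exact ⟨j, by rw [wFactor, Finset.piecewise_eq_of_notMem _ _ _ h, bFactor, if_pos hj]⟩

theorem wTerm_insert_of_val_lt {S T : Finset (Fin n)} {i : Fin n} (hi : i ∉ S)
    (hST : insert i S ⊆ descents T) (hlt : i.val + 1 < n) :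
    wTerm hn hℓ hζ t (insert i S) T = -wTerm hn hℓ hζ t S T := by
  have hv : (i + 1).val = i.val + 1 := Fin.val_add_one_of_lt' hlt
  have hsucc : (⟨i.val + 1, hlt⟩ : Fin n) = i + 1 := Fin.ext hv.symm
  refine prod_ofFn_eq_neg_of_adjacent hlt (fun j hj hj' =>
    wFactor_insert_of_ne (fun h => hj (by rw [h])) (fun h => hj' (by rw [h, hv]))) ?_
  rw [hsucc, Fin.eta, wFactor_insert_self hST, wFactor_insert_succ hST, wFactor_of_notMem hi hST,
    wFactor_succ_of_notMem hi hST, z_mul_b_succ, mul_one, ← neg_smul, neg_neg, tau,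
    if_neg (by omega), sigma]

theorem wTerm_insert_of_val_eq {S T : Finset (Fin n)} {i : Fin n} (hi : i ∉ S)
    (hST : insert i S ⊆ descents T) (hlast : i.val = n - 1) :
    wTerm hn hℓ hζ t (insert i S) T = -wTerm hn hℓ hζ t S T := by
  have hi' : i = ⟨n - 1, by omega⟩ := Fin.ext hlast
  have hzero : i + 1 = ⟨0, by omega⟩ := by
    ext
    rw [Fin.val_add, Fin.val_one', Nat.mod_eq_of_lt (show 1 < n by omega), hlast,
      Nat.sub_add_cancel (by omega), Nat.mod_self]
  have hne (j : Fin n) (hj : j.val ≠ 0) (hj' : j.val ≠ n - 1) : j ≠ i ∧ j ≠ i + 1 :=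
    ⟨fun h => hj' (h ▸ hlast), fun h => hj (by rw [h, hzero])⟩
  refine prod_ofFn_eq_neg_of_ends (by omega)
    (fun j hj hj' => wFactor_insert_of_ne (hne j hj hj').1 (hne j hj hj').2)
    (fun j hj hj' => ?_) ?_
  · rw [← hzero, wFactor_insert_succ hST, wFactor_succ_of_notMem hi hST]
    exact ⟨Commute.one_left _, b_succ_commute_wFactor (hne j hj hj').1 (hne j hj hj').2⟩
  · rw [← hzero, ← hi', wFactor_insert_succ hST, wFactor_insert_self hST,
      wFactor_succ_of_notMem hi hST, wFactor_of_notMem hi hST, b_succ_mul_z, one_mul, ← neg_smul,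
      neg_neg, tau, if_pos hlast, sigma, mul_div_assoc]

theorem wTerm_insert {S T : Finset (Fin n)} {i : Fin n} (hi : i ∉ S)
    (hST : insert i S ⊆ descents T) :
    wTerm hn hℓ hζ t (insert i S) T = -wTerm hn hℓ hζ t S T := by
  rcases lt_or_ge (i.val + 1) n with hlt | hge
  · exact wTerm_insert_of_val_lt hi hST hlt
  · exact wTerm_insert_of_val_eq hi hST (by omega)

theorem wTerm_of_subset_descents {S T : Finset (Fin n)} (hST : S ⊆ descents T) :
    wTerm hn hℓ hζ t S T = (-1 : ℤ) ^ S.card • (List.ofFn (T.piecewise 𝔷 𝔟)).prod := by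
  induction S using Finset.induction_on with
  | empty =>
    rw [Finset.card_empty, pow_zero, one_smul]
    rfl
  | insert i S hi ih =>
    rw [wTerm_insert hi hST, ih ((Finset.subset_insert i S).trans hST),
      Finset.card_insert_of_notMem hi, pow_succ, mul_neg_one, neg_smul]

theorem sum_wTerm (T : Finset (Fin n)) :
    ∑ S ∈ nonadjacentSets n, wTerm hn hℓ hζ t S T
      = if T = ∅ ∨ T = Finset.univ then (List.ofFn (T.piecewise 𝔷 𝔟)).prod else 0 := by
  rw [← Finset.sum_subset (s₁ := (descents T).powerset)
    (fun S hS => mem_nonadjacentSets_of_subset_descents (Finset.mem_powerset.1 hS))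
    fun S hS hS' => wTerm_eq_zero hS fun h => hS' (Finset.mem_powerset.2 h),
    Finset.sum_congr rfl fun S hS => wTerm_of_subset_descents (Finset.mem_powerset.1 hS),
    ← Finset.sum_smul, Finset.sum_powerset_neg_one_pow_card]
  simp only [descents_eq_empty_iff, ite_smul, one_smul, zero_smul]

end Torus

theorem toTorus_w :
    toTorus hn hℓ hζ t (Hecke.w hn hℓ hζ t) = (List.ofFn 𝔷).prod + (List.ofFn 𝔟).prod := by
  have hne : (Finset.univ : Finset (Fin n)) ≠ ∅ := Finset.univ_nonempty.ne_empty
  have hfilter : (Finset.univ.filter fun T : Finset (Fin n) => T = ∅ ∨ T = Finset.univ)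
      = {Finset.univ, ∅} := by
    ext T
    simp [or_comm]
  rw [Hecke.w, map_sum, Finset.sum_congr rfl fun S hS => toTorus_w_summand hS, Finset.sum_comm,
    Finset.sum_congr rfl fun T _ => Torus.sum_wTerm T, ← Finset.sum_filter, hfilter,
    Finset.sum_pair hne, Finset.piecewise_univ, Finset.piecewise_empty]

theorem exists_toTorus_w_eq :
    ∃ e : ℂ, toTorus hn hℓ hζ t (Hecke.w hn hℓ hζ t) =
      𝔪 (fun _ => 1) 1 + e • 𝔪 (fun _ => -1) 1 := by
  obtain ⟨e, he⟩ := Torus.exists_prod_b_eq (hn := hn) (hℓ := hℓ) (hζ := hζ) (t := t)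
  exact ⟨e, by rw [toTorus_w, Torus.prod_z, he]⟩

/-! ### Central elements -/

theorem w_mem_center : Hecke.w hn hℓ hζ t ∈ Subalgebra.center ℂ (Hecke hn hℓ hζ t) := by
  obtain ⟨e, he⟩ := exists_toTorus_w_eq (hn := hn) (hℓ := hℓ) (hζ := hζ) (t := t)
  refine Subalgebra.mem_center_iff.2 fun y => toTorus_injective ?_
  rw [map_mul, map_mul, he]
  exact ((Torus.commute_mono_const 1 _).add_left
    ((Torus.commute_mono_const (-1) _).smul_left e)).eq.symm

namespace Hecke

theorem commute_x_pow (i j : Fin n) : Commute (𝐱 j) (𝐱 i ^ ℓ) := by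
  by_cases hij : Adjacent i j
  · rcases hij with rfl | rfl
    · refine commute_pow_of_geom_sum_eq_zero (c := -t i) (g := 𝐠 (gen hn hℓ hζ i)) (q := ζ) ?_ ?_
        (hζ.geom_sum_eq_zero (by omega))
      · rw [neg_smul, ← x_commutator_succ]
        abel
      · rw [ofGroup_mul_x, entry_gen, genEntry, if_pos rfl]
    · refine commute_pow_of_geom_sum_eq_zero (c := t j) (g := 𝐠 (gen hn hℓ hζ j)) (q := ζ⁻¹) ?_ ?_
        (hζ.inv.geom_sum_eq_zero (by omega))
      · rw [← x_commutator_succ]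
        abel
      · rw [ofGroup_mul_x, entry_gen, genEntry, if_neg (succ_ne hn j), if_pos rfl]
  · exact ((commute_x_of_not_adjacent hij).pow_left ℓ).symm

theorem commute_ofGroup_x_pow (g : diagGroup n ℓ) (i : Fin n) : Commute (𝐠 g) (𝐱 i ^ ℓ) := by
  have hsemiconj : SemiconjBy (𝐠 g) (𝐱 i) ((entry i g : ℂ) • 𝐱 i) := by
    rw [SemiconjBy, ofGroup_mul_x, smul_mul_assoc]
  have hpow := hsemiconj.pow_right ℓ
  rwa [smul_pow, ← Units.val_pow_eq_pow_val, entry_pow, Units.val_one, one_smul] at hpow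

theorem x_pow_mem_center (i : Fin n) : 𝐱 i ^ ℓ ∈ Subalgebra.center ℂ (Hecke hn hℓ hζ t) :=
  mem_center_of_commute (commute_x_pow i) fun g => commute_ofGroup_x_pow g i

end Hecke

variable (hn hℓ hζ t) in
/-- The subalgebra generated by the `x_i ^ ℓ` and `w`, which turns out to be the center. -/
def centralSubalgebra : Subalgebra ℂ (Hecke hn hℓ hζ t) :=
  Algebra.adjoin ℂ (Set.range (fun i => 𝐱 i ^ ℓ) ∪ {Hecke.w hn hℓ hζ t})

theorem x_pow_mem_centralSubalgebra (i : Fin n) : 𝐱 i ^ ℓ ∈ centralSubalgebra hn hℓ hζ t :=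
  Algebra.subset_adjoin (Or.inl ⟨i, rfl⟩)

theorem w_mem_centralSubalgebra : Hecke.w hn hℓ hζ t ∈ centralSubalgebra hn hℓ hζ t :=
  Algebra.subset_adjoin (Or.inr rfl)

theorem centralSubalgebra_le_center :
    centralSubalgebra hn hℓ hζ t ≤ Subalgebra.center ℂ (Hecke hn hℓ hζ t) :=
  Algebra.adjoin_le (by
    rintro _ (⟨i, rfl⟩ | rfl)
    exacts [Hecke.x_pow_mem_center i, w_mem_center])

/-! ### Leading terms of central elements -/

theorem hasLead_toTorus_w :
    HasLead degree (monomial (fun _ => 1) 1) (toTorus hn hℓ hζ t (Hecke.w hn hℓ hζ t)) := by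
  obtain ⟨e, he⟩ := exists_toTorus_w_eq (hn := hn) (hℓ := hℓ) (hζ := hζ) (t := t)
  rw [he, HasLead, Torus.mono, add_sub_cancel_left]
  refine Submodule.smul_mem _ _ (of_mem_degLT ?_)
  simp only [degree_monomial, Finset.sum_const, Finset.card_univ, Fintype.card_fin, nsmul_eq_mul]
  omega

theorem exists_mem_centralSubalgebra_hasLead (q : Fin n → ℕ) (k : ℕ) :
    ∃ y ∈ centralSubalgebra hn hℓ hζ t,
      HasLead degree (monomial (fun j => ((ℓ * q j + k : ℕ) : ℤ)) 1) (toTorus hn hℓ hζ t y) := by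
  refine ⟨(List.ofFn fun j => (𝐱 j ^ ℓ) ^ q j).prod * Hecke.w hn hℓ hζ t ^ k, ?_, ?_⟩
  · refine mul_mem (list_prod_mem fun y hy => ?_) (pow_mem w_mem_centralSubalgebra k)
    obtain ⟨j, rfl⟩ := List.mem_ofFn.1 hy
    exact pow_mem (x_pow_mem_centralSubalgebra j) (q j)
  · have hlead := Torus.hasLead_mul
      (Torus.hasLead_prod_ofFn fun j => Torus.hasLead_pow (Torus.hasLead_pow
        (Torus.hasLead_x (hn := hn) (hℓ := hℓ) (hζ := hζ) (t := t) j) ℓ) (q j))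
      (Torus.hasLead_pow (hasLead_toTorus_w (hn := hn) (hℓ := hℓ) (hζ := hζ) (t := t)) k)
    have hexp : ∑ j, q j • ℓ • (Pi.single j 1 : Fin n → ℤ) + k • (fun _ => 1)
        = fun j => ((ℓ * q j + k : ℕ) : ℤ) := by
      ext i
      simp [Finset.sum_apply, Pi.single_apply, mul_comm]
    rw [hexp] at hlead
    simpa [map_list_prod, List.map_ofFn, Function.comp_def, toTorus_x] using hlead

section CentralLeadingTerm

variable {f : Torus hn hℓ hζ} {p : Fin n → ℤ} {g : diagGroup n ℓ}

theorem eq_one_of_commute_x (hcomm : ∀ i, Commute (𝔵 i) f)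
    (hf : f ∈ degLT (torusCocycle hn hℓ hζ) degree (degree (monomial p g) + 1))
    (hp : coeff (monomial p g) f ≠ 0) : g = 1 := by
  refine eq_of_entry_eq fun i => ?_
  have hswap := (Torus.hasLead_x i).toFun_swap_of_commute degree_mul (Commute.all _ _) hf hp
    (hcomm i)
  rw [Torus.torusCocycle_one_left] at hswap
  simpa [torusCocycle, alphaFun_one_right, weight_single] using hswap.symm

theorem dvd_sub_of_commute_g (hcomm : ∀ h, Commute (𝔤 h) f)
    (hf : f ∈ degLT (torusCocycle hn hℓ hζ) degree (degree (monomial p (1 : diagGroup n ℓ)) + 1))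
    (hp : coeff (monomial p (1 : diagGroup n ℓ)) f ≠ 0) (i : Fin n) :
    (ℓ : ℤ) ∣ p i - p (i + 1) := by
  have hswap := (Torus.hasLead_g (gen hn hℓ hζ i)).toFun_swap_of_commute degree_mul
    (Commute.all _ _) hf hp (hcomm _)
  have hweight : weight p (gen hn hℓ hζ i) = 1 := by
    simpa [torusCocycle, alphaFun_one_left, alphaFun_one_right] using hswap
  rw [← hζ.zpow_eq_one_iff_dvd, ← weight_gen (hn := hn) (hℓ := hℓ) (hζ := hζ), hweight,
    Units.val_one]

end CentralLeadingTerm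

theorem exists_hasLead_of_mem_center {y : Hecke hn hℓ hζ t}
    (hy : y ∈ Subalgebra.center ℂ (Hecke hn hℓ hζ t)) {a : MonomialGroup n ℓ}
    (hya : toTorus hn hℓ hζ t y ∈ degLT (torusCocycle hn hℓ hζ) degree (degree a + 1))
    (ha : coeff a (toTorus hn hℓ hζ t y) ≠ 0) :
    ∃ s ∈ centralSubalgebra hn hℓ hζ t, HasLead degree a (toTorus hn hℓ hζ t s) := by
  obtain ⟨p, g⟩ := a
  obtain ⟨q, rfl⟩ := exists_nat_eq_of_coeff_toTorus_ne_zero (p := p) hya ha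
  have hcomm (u) : Commute (toTorus hn hℓ hζ t u) (toTorus hn hℓ hζ t y) :=
    (show Commute u y from Subalgebra.mem_center_iff.1 hy u).map (toTorus hn hℓ hζ t)
  obtain rfl := eq_one_of_commute_x (fun i => toTorus_x (t := t) i ▸ hcomm (𝐱 i)) hya ha
  have hmod : ∀ i, q i ≡ q 0 [MOD ℓ] := by
    refine cyclic_induction (i := 0) rfl fun i hi => Nat.ModEq.trans ?_ hi
    exact Nat.modEq_iff_dvd.2
      (dvd_sub_of_commute_g (fun h => toTorus_ofGroup (t := t) h ▸ hcomm (𝐠 h)) hya ha i)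
  have hq : q = fun j => ℓ * (q j / ℓ) + q 0 % ℓ :=
    funext fun j => by rw [← hmod j, Nat.div_add_mod]
  rw [hq]
  exact exists_mem_centralSubalgebra_hasLead (fun j => q j / ℓ) (q 0 % ℓ)

theorem center_le_centralSubalgebra :
    Subalgebra.center ℂ (Hecke hn hℓ hζ t) ≤ centralSubalgebra hn hℓ hζ t := by
  let image (S : Subalgebra ℂ (Hecke hn hℓ hζ t)) : Submodule ℂ (Torus hn hℓ hζ) :=
    Subalgebra.toSubmodule (S.map (toTorus hn hℓ hζ t))
  have hle : image (Subalgebra.center ℂ _) ≤ image (centralSubalgebra hn hℓ hζ t) := by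
    refine le_of_forall_hasLead (deg := degree)
      (Subalgebra.map_mono centralSubalgebra_le_center) ?_ ?_
    · rintro _ ⟨u, -, rfl⟩ hu
      exact (congrArg _ (eq_zero_of_toTorus_mem_degLT hu)).trans (map_zero _)
    · rintro _ ⟨u, hu, rfl⟩ a hua ha
      obtain ⟨s, hs, hsa⟩ := exists_hasLead_of_mem_center hu hua ha
      exact ⟨_, ⟨s, hs, rfl⟩, hsa⟩
  intro y hy
  obtain ⟨s, hs, hsy⟩ := hle ⟨y, hy, rfl⟩
  exact toTorus_injective hsy ▸ hs

end Torus

end HomocyclicHecke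

end

theorem theorem2 (n ℓ : ℕ) [NeZero n] (hn : 3 ≤ n) (hℓ : 2 ≤ ℓ) (ζ : ℂ)
    (hζ : IsPrimitiveRoot ζ ℓ) (t : Fin n → ℂ) :
    Subalgebra.center ℂ (HomocyclicHecke.Hecke hn hℓ hζ t) =
      Algebra.adjoin ℂ
        (Set.range (fun i : Fin n => HomocyclicHecke.Hecke.x hn hℓ hζ t i ^ ℓ) ∪
          {HomocyclicHecke.Hecke.w hn hℓ hζ t}) := by
  change Subalgebra.center ℂ _ = HomocyclicHecke.centralSubalgebra hn hℓ hζ t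
  exact le_antisymm HomocyclicHecke.center_le_centralSubalgebra
    HomocyclicHecke.centralSubalgebra_le_center
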